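/- **Conventions.** A $3$-precategory $C$ is a $3$-globular set with identities and, for $1\le k,l\le 3$, a composition of $k$-cells with $l$-cells along a common $(\min(k,l)-1)$-cell (so: $\circ_0$ composes two $1$-cells, and whiskers a $2$- or $3$-cell by a $1$-cell on either side; $\circ_1$ composes two $2$-cells, and whiskers a $3$-cell by a $2$-cell on either side; $\circ_2$ composes two $3$-cells), all written in diagrammatic order. These operations are associative and unital, and whiskering by a cell distributes over composition and preserves identities; no exchange law is imposed. A $4$-prepolygraph $\mathsf P$ consists of sets $\mathsf P_0,\dots,\mathsf P_4$ of generators, where for $k\ge 1$ each $k$-generator has as source and target parallel $(k-1)$-cells of the free $(k-1)$-precategory on the generators of dimension $<k$; $\mathsf P^*_k$ denotes the set of $k$-cells freely generated. It presents the $3$-precategory $\overline{\mathsf P}$ obtained from the free $3$-precategory on $\mathsf P_0,\dots,\mathsf P_3$ by dividing its $3$-cells by the smallest congruence that identifies the source and the target of each $4$-generator. Its localization $\overline{\mathsf P}^{\top}$ is obtained by formally inverting all $3$-cells for $\circ_2$: its $3$-cells are the zigzags of $3$-cells of $\overline{\mathsf P}$ modulo composition of consecutive cells of the same sign, removal of identities,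 and cancellation of a cell with its formal inverse. **Gray presentations.** A Gray presentation is a $4$-prepolygraph $\mathsf P$ with the following distinguished generators. 1. For $0$-composable $\alpha,g,\beta$ with $\alpha:f\Rightarrow f'$ and $\beta:h\Rightarrow h'$ in $\mathsf P_2$ and $g\in\mathsf P_1^*$, an interchange generator $X_{\alpha,g,\beta}\in\mathsf P_3$ of type $$(\alpha\circ_0 g\circ_0 h)\circ_1(f'\circ_0 g\circ_0\beta)\Rrightarrow(f\circ_0 g\circ_0\beta)\circ_1(\alpha\circ_0 g\circ_0 h').$$ For $0$-composable $2$-cells $\varphi:f\Rightarrow f'$ and $\psi:g\Rightarrow g'$ in $\mathsf P_2^*$, let $X_{\varphi,\psi}:(\varphi\circ_0 g)\circ_1(f'\circ_0\psi)\Rrightarrow(f\circ_0\psi)\circ_1(\varphi\circ_0 g')$ be the following composite of interchange generators in context: one exchanges the last generator of $\varphi$ successively with the first, second, …, last generator of $\psi$, then the last but one generator of $\varphi$ in the same way, and so on. 2. For all $A:\varphi\Rrightarrow\varphi'$ and $B:\psi\Rrightarrow\psi'$ in $\mathsf P_3$, all $e,h,e',h'\in\mathsf P_1^*$ and all $\chi\in\mathsf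 P_2^*$ from $e\circ_0 t_1(\varphi)\circ_0 h$ to $e'\circ_0 s_1(\psi)\circ_0 h'$, an independence generator in $\mathsf P_4$ with source $$((e\circ_0 A\circ_0 h)\circ_1\chi\circ_1(e'\circ_0\psi\circ_0 h'))\circ_2((e\circ_0\varphi'\circ_0 h)\circ_1\chi\circ_1(e'\circ_0 B\circ_0 h'))$$ and target $$((e\circ_0\varphi\circ_0 h)\circ_1\chi\circ_1(e'\circ_0 B\circ_0 h'))\circ_2((e\circ_0 A\circ_0 h)\circ_1\chi\circ_1(e'\circ_0\psi'\circ_0 h')).$$ 3. Interchange naturality generators in $\mathsf P_4$: for all $0$-composable $A:\varphi\Rrightarrow\varphi':f\Rightarrow f'$ in $\mathsf P_3$, $g\in\mathsf P_1^*$, $\beta:h\Rightarrow h'$ in $\mathsf P_2$, one with source $((A\circ_0 g\circ_0 h)\circ_1(f'\circ_0 g\circ_0\beta))\circ_2X_{\varphi',g\circ_0\beta}$ and target $X_{\varphi,g\circ_0\beta}\circ_2((f\circ_0 g\circ_0\beta)\circ_1(A\circ_0 g\circ_0 h'))$; and for all $0$-composable $\alpha:f\Rightarrow f'$ in $\mathsf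 P_2$, $g\in\mathsf P_1^*$, $B:\psi\Rrightarrow\psi':h\Rightarrow h'$ in $\mathsf P_3$, one with source $((\alpha\circ_0 g\circ_0 h)\circ_1(f'\circ_0 g\circ_0 B))\circ_2X_{\alpha\circ_0 g,\psi'}$ and target $X_{\alpha\circ_0 g,\psi}\circ_2((f\circ_0 g\circ_0 B)\circ_1(\alpha\circ_0 g\circ_0 h'))$. A $3$-precategory is coherent if any two parallel $3$-cells are equal, and a Gray presentation $\mathsf P$ is coherent if $\overline{\mathsf P}^{\top}$ is coherent. **The presentation $\mathsf{PMon}$.** Let $\mathsf{PMon}_0=\{x\}$, $\mathsf{PMon}_1=\{a:x\to x\}$, and write $\bar n=a\circ_0\cdots\circ_0a$ ($n$ times). Let $\mathsf{PMon}_2=\{\mu:\bar2\Rightarrow\bar1,\ \eta:\bar0\Rightarrow\bar1\}$, and let $\mathsf{PMon}_3$ consist of $$A:(\mu\circ_0\bar1)\circ_1\mu\Rrightarrow(\bar1\circ_0\mu)\circ_1\mu,\qquad L:(\eta\circ_0\bar1)\circ_1\mu\Rrightarrow\mathrm{id}_{\bar1},\qquad R:(\bar1\circ_0\eta)\circ_1\mu\Rrightarrow\mathrm{id}_{\bar1}$$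 and of the interchange generators $X_{\alpha,\bar n,\beta}$ for $\alpha,\beta\in\{\mu,\eta\}$ and $n\in\mathbb N$. Let $\mathsf{PMon}_4$ consist of one independence or interchange naturality generator for each configuration in 2 and 3, and of five further generators with the following sources and targets: - $R_1$: from $((A\circ_0\bar1)\circ_1\mu)\circ_2((\bar1\circ_0\mu\circ_0\bar1)\circ_1A)\circ_2((\bar1\circ_0A)\circ_1\mu)$ to $((\mu\circ_0\bar2)\circ_1A)\circ_2(X_{\mu,\bar0,\mu}\circ_1\mu)\circ_2((\bar2\circ_0\mu)\circ_1A)$; - $R_2$: from $((\eta\circ_0\bar2)\circ_1A)\circ_2(X_{\eta,\bar0,\mu}\circ_1\mu)\circ_2(\mu\circ_1L)$ to $(L\circ_0\bar1)\circ_1\mu$; - $R_3$: from $(X_{\mu,\bar0,\eta}\circ_1\mu)\circ_2((\bar2\circ_0\eta)\circ_1A)\circ_2((\bar1\circ_0R)\circ_1\mu)$ to $\mu\circ_1R$; - $R_4$: from $((\bar1\circ_0\eta\circ_0\bar1)\circ_1A)\circ_2((\bar1\circ_0L)\circ_1\mu)$ to $(R\circ_0\bar1)\circ_1\mu$; - $R_5$: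 from $(X_{\eta,\bar0,\eta}\circ_1\mu)\circ_2(\eta\circ_1L)$ to $\eta\circ_1R$. **Theorem.** $\mathsf{PMon}$ is a coherent Gray presentation: it is a Gray presentation, and any two parallel $3$-cells of $\overline{\mathsf{PMon}}^{\top}$ are equal. -/

import Mathlib

namespace GrayCoherence

/-! ### 3-precategories -/

/-- A `3`-precategory: a `3`-globular set (`C0`, `C1`, `C2`, `C3` with sources `s1`, `s2` and
targets `t1`, `t2`; all cells are grouped by their `0`-source and `0`-target) with identities and
with one composition for each pair of dimensions `k, l`, along a common `(min k l - 1)`-cell: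
* `comp0`: two `1`-cells; `lw2`, `rw2`: a `1`-cell and a `2`-cell; `lw3`, `rw3`: a `1`-cell and a
  `3`-cell (all along a `0`-cell);
* `comp1`: two `2`-cells; `lv3`, `rv3`: a `2`-cell and a `3`-cell (along a `1`-cell);
* `comp2`: two `3`-cells (along a `2`-cell).
Compositions are written in diagrammatic order; no exchange law is required. -/
structure Precat3 where
  C0 : Type
  C1 : C0 → C0 → Type
  C2 : C0 → C0 → Type
  C3 : C0 → C0 → Type
  s1 {x y : C0} : C2 x y → C1 x y
  t1 {x y : C0} : C2 x y → C1 x y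
  s2 {x y : C0} : C3 x y → C2 x y
  t2 {x y : C0} : C3 x y → C2 x y
  s1_t2 {x y : C0} (F : C3 x y) : s1 (t2 F) = s1 (s2 F)
  t1_t2 {x y : C0} (F : C3 x y) : t1 (t2 F) = t1 (s2 F)
  id1 (x : C0) : C1 x x
  id2 {x y : C0} : C1 x y → C2 x y
  id3 {x y : C0} : C2 x y → C3 x y
  comp0 {x y z : C0} : C1 x y → C1 y z → C1 x z
  lw2 {x y z : C0} : C1 x y → C2 y z → C2 x z
  rw2 {x y z : C0} : C2 x y → C1 y z → C2 x z
  lw3 {x y z : C0} : C1 x y → C3 y z → C3 x z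
  rw3 {x y z : C0} : C3 x y → C1 y z → C3 x z
  comp1 {x y : C0} (φ ψ : C2 x y) : t1 φ = s1 ψ → C2 x y
  lv3 {x y : C0} (φ : C2 x y) (F : C3 x y) : t1 φ = s1 (s2 F) → C3 x y
  rv3 {x y : C0} (F : C3 x y) (φ : C2 x y) : t1 (s2 F) = s1 φ → C3 x y
  comp2 {x y : C0} (F G : C3 x y) : t2 F = s2 G → C3 x y
  -- sources and targets of identities
  s1_id2 {x y : C0} (f : C1 x y) : s1 (id2 f) = f
  t1_id2 {x y : C0} (f : C1 x y) : t1 (id2 f) = f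
  s2_id3 {x y : C0} (φ : C2 x y) : s2 (id3 φ) = φ
  t2_id3 {x y : C0} (φ : C2 x y) : t2 (id3 φ) = φ
  -- sources and targets of composites
  s1_lw2 {x y z : C0} (f : C1 x y) (φ : C2 y z) : s1 (lw2 f φ) = comp0 f (s1 φ)
  t1_lw2 {x y z : C0} (f : C1 x y) (φ : C2 y z) : t1 (lw2 f φ) = comp0 f (t1 φ)
  s1_rw2 {x y z : C0} (φ : C2 x y) (f : C1 y z) : s1 (rw2 φ f) = comp0 (s1 φ) f
  t1_rw2 {x y z : C0} (φ : C2 x y) (f : C1 y z) : t1 (rw2 φ f) = comp0 (t1 φ) f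
  s2_lw3 {x y z : C0} (f : C1 x y) (F : C3 y z) : s2 (lw3 f F) = lw2 f (s2 F)
  t2_lw3 {x y z : C0} (f : C1 x y) (F : C3 y z) : t2 (lw3 f F) = lw2 f (t2 F)
  s2_rw3 {x y z : C0} (F : C3 x y) (f : C1 y z) : s2 (rw3 F f) = rw2 (s2 F) f
  t2_rw3 {x y z : C0} (F : C3 x y) (f : C1 y z) : t2 (rw3 F f) = rw2 (t2 F) f
  s1_comp1 {x y : C0} (φ ψ : C2 x y) (h) : s1 (comp1 φ ψ h) = s1 φ
  t1_comp1 {x y : C0} (φ ψ : C2 x y) (h) : t1 (comp1 φ ψ h) = t1 ψ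
  s2_lv3 {x y : C0} (φ : C2 x y) (F : C3 x y) (h) : s2 (lv3 φ F h) = comp1 φ (s2 F) h
  t2_lv3 {x y : C0} (φ : C2 x y) (F : C3 x y) (h h') : t2 (lv3 φ F h) = comp1 φ (t2 F) h'
  s2_rv3 {x y : C0} (F : C3 x y) (φ : C2 x y) (h) : s2 (rv3 F φ h) = comp1 (s2 F) φ h
  t2_rv3 {x y : C0} (F : C3 x y) (φ : C2 x y) (h h') : t2 (rv3 F φ h) = comp1 (t2 F) φ h'
  s2_comp2 {x y : C0} (F G : C3 x y) (h) : s2 (comp2 F G h) = s2 F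
  t2_comp2 {x y : C0} (F G : C3 x y) (h) : t2 (comp2 F G h) = t2 G
  -- identities and compositions
  id1_comp0 {x y : C0} (f : C1 x y) : comp0 (id1 x) f = f
  comp0_id1 {x y : C0} (f : C1 x y) : comp0 f (id1 y) = f
  id1_lw2 {x y : C0} (φ : C2 x y) : lw2 (id1 x) φ = φ
  rw2_id1 {x y : C0} (φ : C2 x y) : rw2 φ (id1 y) = φ
  id1_lw3 {x y : C0} (F : C3 x y) : lw3 (id1 x) F = F
  rw3_id1 {x y : C0} (F : C3 x y) : rw3 F (id1 y) = F
  lw2_id2 {x y z : C0} (f : C1 x y) (g : C1 y z) : lw2 f (id2 g) = id2 (comp0 f g)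
  id2_rw2 {x y z : C0} (f : C1 x y) (g : C1 y z) : rw2 (id2 f) g = id2 (comp0 f g)
  lw3_id3 {x y z : C0} (f : C1 x y) (φ : C2 y z) : lw3 f (id3 φ) = id3 (lw2 f φ)
  id3_rw3 {x y z : C0} (φ : C2 x y) (f : C1 y z) : rw3 (id3 φ) f = id3 (rw2 φ f)
  id2_comp1 {x y : C0} (f : C1 x y) (φ : C2 x y) (h) : comp1 (id2 f) φ h = φ
  comp1_id2 {x y : C0} (φ : C2 x y) (f : C1 x y) (h) : comp1 φ (id2 f) h = φ
  id2_lv3 {x y : C0} (f : C1 x y) (F : C3 x y) (h) : lv3 (id2 f) F h = F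
  rv3_id2 {x y : C0} (F : C3 x y) (f : C1 x y) (h) : rv3 F (id2 f) h = F
  lv3_id3 {x y : C0} (φ ψ : C2 x y) (h h') : lv3 φ (id3 ψ) h = id3 (comp1 φ ψ h')
  id3_rv3 {x y : C0} (φ ψ : C2 x y) (h h') : rv3 (id3 φ) ψ h = id3 (comp1 φ ψ h')
  id3_comp2 {x y : C0} (φ : C2 x y) (F : C3 x y) (h) : comp2 (id3 φ) F h = F
  comp2_id3 {x y : C0} (F : C3 x y) (φ : C2 x y) (h) : comp2 F (id3 φ) h = F
  -- associativity
  comp0_assoc {w x y z : C0} (f : C1 w x) (g : C1 x y) (h : C1 y z) :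
    comp0 (comp0 f g) h = comp0 f (comp0 g h)
  lw2_comp0 {w x y z : C0} (f : C1 w x) (g : C1 x y) (φ : C2 y z) :
    lw2 (comp0 f g) φ = lw2 f (lw2 g φ)
  lw2_rw2 {w x y z : C0} (f : C1 w x) (φ : C2 x y) (g : C1 y z) :
    rw2 (lw2 f φ) g = lw2 f (rw2 φ g)
  rw2_comp0 {w x y z : C0} (φ : C2 w x) (f : C1 x y) (g : C1 y z) :
    rw2 (rw2 φ f) g = rw2 φ (comp0 f g)
  lw3_comp0 {w x y z : C0} (f : C1 w x) (g : C1 x y) (F : C3 y z) :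
    lw3 (comp0 f g) F = lw3 f (lw3 g F)
  lw3_rw3 {w x y z : C0} (f : C1 w x) (F : C3 x y) (g : C1 y z) :
    rw3 (lw3 f F) g = lw3 f (rw3 F g)
  rw3_comp0 {w x y z : C0} (F : C3 w x) (f : C1 x y) (g : C1 y z) :
    rw3 (rw3 F f) g = rw3 F (comp0 f g)
  comp1_assoc {x y : C0} (φ ψ χ : C2 x y) (h₁ h₂ h₃ h₄) :
    comp1 (comp1 φ ψ h₁) χ h₂ = comp1 φ (comp1 ψ χ h₃) h₄
  lv3_comp1 {x y : C0} (φ ψ : C2 x y) (F : C3 x y) (h₁ h₂ h₃ h₄) :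
    lv3 (comp1 φ ψ h₁) F h₂ = lv3 φ (lv3 ψ F h₃) h₄
  lv3_rv3 {x y : C0} (φ : C2 x y) (F : C3 x y) (ψ : C2 x y) (h₁ h₂ h₃ h₄) :
    rv3 (lv3 φ F h₁) ψ h₂ = lv3 φ (rv3 F ψ h₃) h₄
  rv3_comp1 {x y : C0} (F : C3 x y) (φ ψ : C2 x y) (h₁ h₂ h₃ h₄) :
    rv3 (rv3 F φ h₁) ψ h₂ = rv3 F (comp1 φ ψ h₃) h₄
  comp2_assoc {x y : C0} (F G H : C3 x y) (h₁ h₂ h₃ h₄) :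
    comp2 (comp2 F G h₁) H h₂ = comp2 F (comp2 G H h₃) h₄
  -- distributivity
  lw2_comp1 {x y z : C0} (f : C1 x y) (φ ψ : C2 y z) (h h') :
    lw2 f (comp1 φ ψ h) = comp1 (lw2 f φ) (lw2 f ψ) h'
  rw2_comp1 {x y z : C0} (φ ψ : C2 x y) (f : C1 y z) (h h') :
    rw2 (comp1 φ ψ h) f = comp1 (rw2 φ f) (rw2 ψ f) h'
  lw3_lv3 {x y z : C0} (f : C1 x y) (φ : C2 y z) (F : C3 y z) (h h') :
    lw3 f (lv3 φ F h) = lv3 (lw2 f φ) (lw3 f F) h'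
  lw3_rv3 {x y z : C0} (f : C1 x y) (F : C3 y z) (φ : C2 y z) (h h') :
    lw3 f (rv3 F φ h) = rv3 (lw3 f F) (lw2 f φ) h'
  rw3_lv3 {x y z : C0} (φ : C2 x y) (F : C3 x y) (f : C1 y z) (h h') :
    rw3 (lv3 φ F h) f = lv3 (rw2 φ f) (rw3 F f) h'
  rw3_rv3 {x y z : C0} (F : C3 x y) (φ : C2 x y) (f : C1 y z) (h h') :
    rw3 (rv3 F φ h) f = rv3 (rw3 F f) (rw2 φ f) h'
  lw3_comp2 {x y z : C0} (f : C1 x y) (F G : C3 y z) (h h') :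
    lw3 f (comp2 F G h) = comp2 (lw3 f F) (lw3 f G) h'
  rw3_comp2 {x y z : C0} (F G : C3 x y) (f : C1 y z) (h h') :
    rw3 (comp2 F G h) f = comp2 (rw3 F f) (rw3 G f) h'
  lv3_comp2 {x y : C0} (φ : C2 x y) (F G : C3 x y) (h₁ h₂ h₃ h₄ h₅) :
    lv3 φ (comp2 F G h₁) h₂ = comp2 (lv3 φ F h₃) (lv3 φ G h₄) h₅
  rv3_comp2 {x y : C0} (F G : C3 x y) (φ : C2 x y) (h₁ h₂ h₃ h₄ h₅) :
    rv3 (comp2 F G h₁) φ h₂ = comp2 (rv3 F φ h₃) (rv3 G φ h₄) h₅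

/-- A `3`-precategory is coherent when any two parallel `3`-cells are equal. -/
def Precat3.Coherent (C : Precat3) : Prop :=
  ∀ (x y : C.C0) (F G : C.C3 x y), C.s2 F = C.s2 G → C.t2 F = C.t2 G → F = G

/-! ### Chains of labelled steps -/

/-- `IsChain step a es b`: the labels `es` form a chain of steps from `a` to `b`. -/
def IsChain {O E : Type} (step : E → O → O → Prop) : O → List E → O → Prop
  | a, [], b => a = b
  | a, e :: es, b => ∃ c, step e a c ∧ IsChain step c es b

/-- A chain of steps, with its source and its target. -/
@[ext]
structure Chain {O E : Type} (step : E → O → O → Prop) where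
  src : O
  tgt : O
  steps : List E
  valid : IsChain step src steps tgt

theorem IsChain.append {O E : Type} {step : E → O → O → Prop} {a b c : O} {es es' : List E}
    (h : IsChain step a es b) (h' : IsChain step b es' c) : IsChain step a (es ++ es') c := by
  induction es generalizing a with
  | nil => cases h; exact h'
  | cons e es ih =>
    obtain ⟨d, hd, h⟩ := h
    exact ⟨d, hd, ih h⟩

theorem IsChain.map {O E O' E' : Type} {step : E → O → O → Prop} {step' : E' → O' → O' → Prop}
    (fo : O → O') (fe : E → E') (hf : ∀ e a b, step e a b → step' (fe e) (fo a) (fo b))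
    {a b : O} {es : List E} (h : IsChain step a es b) :
    IsChain step' (fo a) (es.map fe) (fo b) := by
  induction es generalizing a with
  | nil => exact congrArg fo h
  | cons e es ih =>
    obtain ⟨d, hd, h⟩ := h
    exact ⟨fo d, hf _ _ _ hd, ih h⟩

namespace Chain

/-- The empty chain. -/
def id {O E : Type} {step : E → O → O → Prop} (a : O) : Chain step :=
  ⟨a, a, [], rfl⟩

/-- The chain with one step. -/
def single {O E : Type} {step : E → O → O → Prop} (e : E) (a b : O) (h : step e a b) :
    Chain step :=
  ⟨a, b, [e], b, h, rfl⟩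

/-- Concatenation of chains. -/
def comp {O E : Type} {step : E → O → O → Prop} (p q : Chain step) (h : p.tgt = q.src) :
    Chain step :=
  ⟨p.src, q.tgt, p.steps ++ q.steps, p.valid.append (h ▸ q.valid)⟩

/-- The image of a chain under a map of objects and labels that preserves steps. -/
def map {O E O' E' : Type} {step : E → O → O → Prop} {step' : E' → O' → O' → Prop}
    (fo : O → O') (fe : E → E') (hf : ∀ e a b, step e a b → step' (fe e) (fo a) (fo b))
    (p : Chain step) : Chain step' :=
  ⟨fo p.src, fo p.tgt, p.steps.map fe, p.valid.map fo fe hf⟩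

end Chain

/-! ### Prepolygraphs and the cells they generate -/

/-- A `1`-prepolygraph: `0`-generators and `1`-generators. -/
structure Pol1 where
  P0 : Type
  P1 : P0 → P0 → Type

instance (P : Pol1) : Quiver P.P0 := ⟨P.P1⟩

/-- The `1`-cells generated by a `1`-prepolygraph: the morphisms of the free category. -/
abbrev Pol1.Cell1 (P : Pol1) (x y : P.P0) : Type := Quiver.Path x y

/-- A `2`-prepolygraph: a `1`-prepolygraph and `2`-generators between parallel `1`-cells. -/
structure Pol2 extends Pol1 where
  P2 : P0 → P0 → Type
  src2 {x y : P0} : P2 x y → toPol1.Cell1 x y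
  tgt2 {x y : P0} : P2 x y → toPol1.Cell1 x y

/-- A whisker `l ∘₀ α ∘₀ r` of dimension `2`. -/
@[ext]
structure Whisker2 (P : Pol2) (x y : P.P0) where
  {x' : P.P0}
  {y' : P.P0}
  l : P.Cell1 x x'
  α : P.P2 x' y'
  r : P.Cell1 y' y

namespace Whisker2

variable {P : Pol2} {x y z : P.P0}

def src (w : Whisker2 P x y) : P.Cell1 x y := (w.l.comp (P.src2 w.α)).comp w.r

def tgt (w : Whisker2 P x y) : P.Cell1 x y := (w.l.comp (P.tgt2 w.α)).comp w.r

def lw (f : P.Cell1 x y) (w : Whisker2 P y z) : Whisker2 P x z := ⟨f.comp w.l, w.α, w.r⟩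

def rw (w : Whisker2 P x y) (f : P.Cell1 y z) : Whisker2 P x z := ⟨w.l, w.α, w.r.comp f⟩

/-- `w` is a step from `w.src` to `w.tgt`. -/
def Step (w : Whisker2 P x y) (f g : P.Cell1 x y) : Prop := f = w.src ∧ g = w.tgt

theorem step_lw (f : P.Cell1 x y) (w : Whisker2 P y z) (a b : P.Cell1 y z) (h : w.Step a b) :
    (lw f w).Step (f.comp a) (f.comp b) := by
  obtain ⟨rfl, rfl⟩ := h
  simp [Step, src, tgt, lw, Quiver.Path.comp_assoc]

theorem step_rw (f : P.Cell1 y z) (w : Whisker2 P x y) (a b : P.Cell1 x y) (h : w.Step a b) :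
    (rw w f).Step (a.comp f) (b.comp f) := by
  obtain ⟨rfl, rfl⟩ := h
  simp [Step, src, tgt, rw, Quiver.Path.comp_assoc]

end Whisker2

/-- The `2`-cells generated by a `2`-prepolygraph, in normal form: chains of whiskers
`(l₁ ∘₀ α₁ ∘₀ r₁) ∘₁ ⋯ ∘₁ (lₖ ∘₀ αₖ ∘₀ rₖ)`. Note that there is no exchange law. -/
abbrev Cell2 (P : Pol2) (x y : P.P0) : Type := Chain (Whisker2.Step (P := P) (x := x) (y := y))

namespace Cell2

variable {P : Pol2} {x y z : P.P0}

/-- The `2`-cell given by a whisker. -/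
def ofWhisker (w : Whisker2 P x y) : Cell2 P x y := Chain.single w w.src w.tgt ⟨rfl, rfl⟩

/-- The `2`-cell given by a generator. -/
def gen (α : P.P2 x y) : Cell2 P x y :=
  Chain.single ⟨.nil, α, .nil⟩ (P.src2 α) (P.tgt2 α)
    ⟨by simp [Whisker2.src], by simp [Whisker2.tgt]⟩

/-- `f ∘₀ φ` -/
def lw (f : P.Cell1 x y) (φ : Cell2 P y z) : Cell2 P x z :=
  φ.map (f.comp) (Whisker2.lw f) (Whisker2.step_lw f)

/-- `φ ∘₀ f` -/
def rw (φ : Cell2 P x y) (f : P.Cell1 y z) : Cell2 P x z :=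
  φ.map (fun g => g.comp f) (fun w => w.rw f) (Whisker2.step_rw f)

end Cell2

/-- A `3`-prepolygraph: a `2`-prepolygraph and `3`-generators between parallel `2`-cells. -/
structure Pol3 extends Pol2 where
  P3 : P0 → P0 → Type
  src3 {x y : P0} : P3 x y → Cell2 toPol2 x y
  tgt3 {x y : P0} : P3 x y → Cell2 toPol2 x y
  src_tgt3 {x y : P0} (A : P3 x y) : (tgt3 A).src = (src3 A).src
  tgt_tgt3 {x y : P0} (A : P3 x y) : (tgt3 A).tgt = (src3 A).tgt

/-- A whisker `λ ∘₁ (l ∘₀ A ∘₀ r) ∘₁ ρ` of dimension `3` (a rewriting step). Only the whiskers of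
the `2`-cells `λ` and `ρ` are recorded, since their boundaries are determined by the rest; the
composability of the data is part of `Whisker3.Step`. -/
@[ext]
structure Whisker3 (P : Pol3) (x y : P.P0) where
  {x' : P.P0}
  {y' : P.P0}
  top : List (Whisker2 P.toPol2 x y)
  l : P.Cell1 x x'
  A : P.P3 x' y'
  r : P.Cell1 y' y
  bot : List (Whisker2 P.toPol2 x y)

namespace Whisker3

variable {P : Pol3} {x y z : P.P0}

/-- `l ∘₀ s(A) ∘₀ r` -/
def midSrc (W : Whisker3 P x y) : Cell2 P.toPol2 x y := ((P.src3 W.A).lw W.l).rw W.r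

/-- `l ∘₀ t(A) ∘₀ r` -/
def midTgt (W : Whisker3 P x y) : Cell2 P.toPol2 x y := ((P.tgt3 W.A).lw W.l).rw W.r

/-- `W` is a step from `φ` to `ψ`: for the `2`-cells `λ` and `ρ` with whiskers `W.top` and
`W.bot`, one has `φ = λ ∘₁ (l ∘₀ s(A) ∘₀ r) ∘₁ ρ` and `ψ = λ ∘₁ (l ∘₀ t(A) ∘₀ r) ∘₁ ρ`. -/
def Step (W : Whisker3 P x y) (φ ψ : Cell2 P.toPol2 x y) : Prop :=
  ∃ (lam rho : Cell2 P.toPol2 x y) (h₁ : lam.tgt = W.midSrc.src) (h₂ : W.midSrc.tgt = rho.src)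
    (h₁' : lam.tgt = W.midTgt.src) (h₂' : W.midTgt.tgt = rho.src),
    lam.steps = W.top ∧ rho.steps = W.bot ∧
    φ = lam.comp (W.midSrc.comp rho h₂) h₁ ∧ ψ = lam.comp (W.midTgt.comp rho h₂') h₁'

def lw (f : P.Cell1 x y) (W : Whisker3 P y z) : Whisker3 P x z :=
  ⟨W.top.map (Whisker2.lw f), f.comp W.l, W.A, W.r, W.bot.map (Whisker2.lw f)⟩

def rw (W : Whisker3 P x y) (f : P.Cell1 y z) : Whisker3 P x z :=
  ⟨W.top.map (fun w => w.rw f), W.l, W.A, W.r.comp f, W.bot.map (fun w => w.rw f)⟩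

def lv (ws : List (Whisker2 P.toPol2 x y)) (W : Whisker3 P x y) : Whisker3 P x y :=
  ⟨ws ++ W.top, W.l, W.A, W.r, W.bot⟩

def rv (W : Whisker3 P x y) (ws : List (Whisker2 P.toPol2 x y)) : Whisker3 P x y :=
  ⟨W.top, W.l, W.A, W.r, W.bot ++ ws⟩

end Whisker3

theorem Whisker2.lw_nil {P : Pol2} {x y : P.P0} :
    Whisker2.lw (P := P) (.nil : P.Cell1 x x) = fun (w : Whisker2 P x y) => w := by
  funext w; simp [Whisker2.lw]

theorem Whisker3.lw_nil {P : Pol3} {x y : P.P0} :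
    Whisker3.lw (P := P) (.nil : P.Cell1 x x) = fun (W : Whisker3 P x y) => W := by
  funext W; simp [Whisker3.lw, Whisker2.lw_nil]

namespace Cell2

variable {P : Pol2} {w x y z : P.P0}

theorem lw_comp (f : P.Cell1 x y) (φ ψ : Cell2 P y z) (h : φ.tgt = ψ.src)
    (h' : (lw f φ).tgt = (lw f ψ).src) :
    lw f (φ.comp ψ h) = (lw f φ).comp (lw f ψ) h' := by
  ext1 <;> simp [lw, Chain.map, Chain.comp]

theorem rw_comp (φ ψ : Cell2 P x y) (f : P.Cell1 y z) (h : φ.tgt = ψ.src)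
    (h' : (rw φ f).tgt = (rw ψ f).src) :
    rw (φ.comp ψ h) f = (rw φ f).comp (rw ψ f) h' := by
  ext1 <;> simp [rw, Chain.map, Chain.comp]

theorem lw_nil (φ : Cell2 P x y) : lw .nil φ = φ := by
  ext1 <;> simp [lw, Chain.map, Whisker2.lw_nil]

theorem rw_nil (φ : Cell2 P x y) : rw φ .nil = φ := by
  ext1 <;> simp [rw, Chain.map, Whisker2.rw]

theorem lw_lw (f : P.Cell1 w x) (g : P.Cell1 x y) (φ : Cell2 P y z) :
    lw (f.comp g) φ = lw f (lw g φ) := by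
  ext1 <;> simp [lw, Chain.map, Whisker2.lw, Quiver.Path.comp_assoc]

theorem lw_rw (f : P.Cell1 w x) (φ : Cell2 P x y) (g : P.Cell1 y z) :
    rw (lw f φ) g = lw f (rw φ g) := by
  ext1 <;> simp [lw, rw, Chain.map, Whisker2.lw, Whisker2.rw, Quiver.Path.comp_assoc]

theorem rw_rw (φ : Cell2 P w x) (f : P.Cell1 x y) (g : P.Cell1 y z) :
    rw (rw φ f) g = rw φ (f.comp g) := by
  ext1 <;> simp [rw, Chain.map, Whisker2.rw, Quiver.Path.comp_assoc]

end Cell2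

namespace Whisker3

variable {P : Pol3} {x y z : P.P0}

theorem midSrc_lw (f : P.Cell1 x y) (W : Whisker3 P y z) :
    (lw f W).midSrc = Cell2.lw f W.midSrc := by
  simp [lw, midSrc, Cell2.lw_lw, Cell2.lw_rw]

theorem midTgt_lw (f : P.Cell1 x y) (W : Whisker3 P y z) :
    (lw f W).midTgt = Cell2.lw f W.midTgt := by
  simp [lw, midTgt, Cell2.lw_lw, Cell2.lw_rw]

theorem midSrc_rw (W : Whisker3 P x y) (f : P.Cell1 y z) :
    (rw W f).midSrc = Cell2.rw W.midSrc f := by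
  simp [rw, midSrc, Cell2.rw_rw]

theorem midTgt_rw (W : Whisker3 P x y) (f : P.Cell1 y z) :
    (rw W f).midTgt = Cell2.rw W.midTgt f := by
  simp [rw, midTgt, Cell2.rw_rw]

theorem step_lw (f : P.Cell1 x y) (W : Whisker3 P y z) (a b : Cell2 P.toPol2 y z)
    (h : W.Step a b) : (lw f W).Step (Cell2.lw f a) (Cell2.lw f b) := by
  obtain ⟨lam, rho, h₁, h₂, h₁', h₂', ht, hb, rfl, rfl⟩ := h
  refine ⟨Cell2.lw f lam, Cell2.lw f rho, ?_, ?_, ?_, ?_, ?_, ?_, ?_, ?_⟩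
  · rw [midSrc_lw]; exact congrArg f.comp h₁
  · rw [midSrc_lw]; exact congrArg f.comp h₂
  · rw [midTgt_lw]; exact congrArg f.comp h₁'
  · rw [midTgt_lw]; exact congrArg f.comp h₂'
  · simp [lw, Cell2.lw, Chain.map, ht]
  · simp [lw, Cell2.lw, Chain.map, hb]
  · ext1 <;> simp [midSrc_lw, Chain.comp, Cell2.lw, Chain.map]
  · ext1 <;> simp [midTgt_lw, Chain.comp, Cell2.lw, Chain.map]

theorem step_rw (f : P.Cell1 y z) (W : Whisker3 P x y) (a b : Cell2 P.toPol2 x y)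
    (h : W.Step a b) : (rw W f).Step (Cell2.rw a f) (Cell2.rw b f) := by
  obtain ⟨lam, rho, h₁, h₂, h₁', h₂', ht, hb, rfl, rfl⟩ := h
  refine ⟨Cell2.rw lam f, Cell2.rw rho f, ?_, ?_, ?_, ?_, ?_, ?_, ?_, ?_⟩
  · rw [midSrc_rw]; exact congrArg (fun g => Quiver.Path.comp g f) h₁
  · rw [midSrc_rw]; exact congrArg (fun g => Quiver.Path.comp g f) h₂
  · rw [midTgt_rw]; exact congrArg (fun g => Quiver.Path.comp g f) h₁'
  · rw [midTgt_rw]; exact congrArg (fun g => Quiver.Path.comp g f) h₂'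
  · simp [rw, Cell2.rw, Chain.map, ht]
  · simp [rw, Cell2.rw, Chain.map, hb]
  · ext1 <;> simp [midSrc_rw, Chain.comp, Cell2.rw, Chain.map]
  · ext1 <;> simp [midTgt_rw, Chain.comp, Cell2.rw, Chain.map]

theorem Step.src_eq {W : Whisker3 P x y} {a b : Cell2 P.toPol2 x y} (h : W.Step a b) :
    b.src = a.src := by
  obtain ⟨lam, rho, h₁, h₂, h₁', h₂', ht, hb, rfl, rfl⟩ := h
  rfl

theorem Step.tgt_eq {W : Whisker3 P x y} {a b : Cell2 P.toPol2 x y} (h : W.Step a b) :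
    b.tgt = a.tgt := by
  obtain ⟨lam, rho, h₁, h₂, h₁', h₂', ht, hb, rfl, rfl⟩ := h
  rfl

theorem step_lv (φ : Cell2 P.toPol2 x y) (W : Whisker3 P x y) (a b : Cell2 P.toPol2 x y)
    (h : W.Step a b) (ha : φ.tgt = a.src) (hb : φ.tgt = b.src) :
    (lv φ.steps W).Step (φ.comp a ha) (φ.comp b hb) := by
  obtain ⟨lam, rho, h₁, h₂, h₁', h₂', ht, hr, rfl, rfl⟩ := h
  refine ⟨φ.comp lam ha, rho, h₁, h₂, h₁', h₂', ?_, hr, ?_, ?_⟩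
  · simp [lv, Chain.comp, ht]
  · ext1 <;> simp [Chain.comp, lv, midSrc]
  · ext1 <;> simp [Chain.comp, lv, midTgt]

theorem step_rv (φ : Cell2 P.toPol2 x y) (W : Whisker3 P x y) (a b : Cell2 P.toPol2 x y)
    (h : W.Step a b) (ha : a.tgt = φ.src) (hb : b.tgt = φ.src) :
    (rv W φ.steps).Step (a.comp φ ha) (b.comp φ hb) := by
  obtain ⟨lam, rho, h₁, h₂, h₁', h₂', ht, hr, rfl, rfl⟩ := h
  refine ⟨lam, rho.comp φ ha, h₁, h₂, h₁', h₂', ht, ?_, ?_, ?_⟩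
  · simp [rv, Chain.comp, hr]
  · ext1 <;> simp [Chain.comp, rv, midSrc]
  · ext1 <;> simp [Chain.comp, rv, midTgt]

theorem step_of_mid {W : Whisker3 P x y} {a b : Cell2 P.toPol2 x y} (ht : W.top = [])
    (hb : W.bot = []) (hs : W.midSrc = a) (ht' : W.midTgt = b) (h : b.src = a.src)
    (h' : b.tgt = a.tgt) : W.Step a b := by
  subst hs ht'
  refine ⟨Chain.id W.midSrc.src, Chain.id W.midSrc.tgt, rfl, rfl, h.symm, h', ht.symm, hb.symm,
    ?_, ?_⟩
  · ext1 <;> simp [Chain.comp, Chain.id]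
  · ext1 <;> simp [Chain.comp, Chain.id, h, h']

end Whisker3

/-- The `3`-cells generated by a `3`-prepolygraph, in normal form: chains of whiskers
`λ ∘₁ (l ∘₀ A ∘₀ r) ∘₁ ρ` composed along `2`-cells (rewriting paths). -/
abbrev Cell3 (P : Pol3) (x y : P.P0) : Type := Chain (Whisker3.Step (P := P) (x := x) (y := y))

namespace Cell3

variable {P : Pol3} {x y z : P.P0}

theorem isChain_src {a b : Cell2 P.toPol2 x y} {es : List (Whisker3 P x y)}
    (h : IsChain Whisker3.Step a es b) : b.src = a.src := by
  induction es generalizing a with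
  | nil => cases h; rfl
  | cons e es ih => obtain ⟨c, hc, h⟩ := h; exact (ih h).trans hc.src_eq

theorem isChain_tgt {a b : Cell2 P.toPol2 x y} {es : List (Whisker3 P x y)}
    (h : IsChain Whisker3.Step a es b) : b.tgt = a.tgt := by
  induction es generalizing a with
  | nil => cases h; rfl
  | cons e es ih => obtain ⟨c, hc, h⟩ := h; exact (ih h).trans hc.tgt_eq

theorem src_tgt (F : Cell3 P x y) : F.tgt.src = F.src.src := isChain_src F.valid

theorem tgt_tgt (F : Cell3 P x y) : F.tgt.tgt = F.src.tgt := isChain_tgt F.valid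

theorem isChain_lv (φ : Cell2 P.toPol2 x y) {a b : Cell2 P.toPol2 x y}
    {es : List (Whisker3 P x y)} (h : IsChain Whisker3.Step a es b)
    (ha : φ.tgt = a.src) (hb : φ.tgt = b.src) :
    IsChain Whisker3.Step (φ.comp a ha) (es.map (Whisker3.lv φ.steps)) (φ.comp b hb) := by
  induction es generalizing a with
  | nil => cases h; rfl
  | cons e es ih =>
    obtain ⟨c, hc, h⟩ := h
    exact ⟨φ.comp c (ha.trans hc.src_eq.symm), Whisker3.step_lv _ _ _ _ hc _ _, ih h _⟩

theorem isChain_rv (φ : Cell2 P.toPol2 x y) {a b : Cell2 P.toPol2 x y}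
    {es : List (Whisker3 P x y)} (h : IsChain Whisker3.Step a es b)
    (ha : a.tgt = φ.src) (hb : b.tgt = φ.src) :
    IsChain Whisker3.Step (a.comp φ ha) (es.map (fun W => W.rv φ.steps)) (b.comp φ hb) := by
  induction es generalizing a with
  | nil => cases h; rfl
  | cons e es ih =>
    obtain ⟨c, hc, h⟩ := h
    exact ⟨c.comp φ (hc.tgt_eq.trans ha), Whisker3.step_rv _ _ _ _ hc _ _, ih h _⟩

/-- The `3`-cell given by a generator. -/
def gen (A : P.P3 x y) : Cell3 P x y :=
  Chain.single ⟨[], .nil, A, .nil, []⟩ (P.src3 A) (P.tgt3 A) <|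
    Whisker3.step_of_mid rfl rfl (by simp [Whisker3.midSrc, Cell2.lw_nil, Cell2.rw_nil])
      (by simp [Whisker3.midTgt, Cell2.lw_nil, Cell2.rw_nil]) (P.src_tgt3 A) (P.tgt_tgt3 A)

/-- `f ∘₀ F` -/
def lw (f : P.Cell1 x y) (F : Cell3 P y z) : Cell3 P x z :=
  F.map (Cell2.lw f) (Whisker3.lw f) (Whisker3.step_lw f)

/-- `F ∘₀ f` -/
def rw (F : Cell3 P x y) (f : P.Cell1 y z) : Cell3 P x z :=
  F.map (fun φ => Cell2.rw φ f) (fun W => W.rw f) (Whisker3.step_rw f)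

/-- `φ ∘₁ F` -/
def lv (φ : Cell2 P.toPol2 x y) (F : Cell3 P x y) (h : φ.tgt = F.src.src) : Cell3 P x y :=
  ⟨φ.comp F.src h, φ.comp F.tgt (h.trans F.src_tgt.symm), F.steps.map (Whisker3.lv φ.steps),
    isChain_lv φ F.valid _ _⟩

/-- `F ∘₁ φ` -/
def rv (F : Cell3 P x y) (φ : Cell2 P.toPol2 x y) (h : F.src.tgt = φ.src) : Cell3 P x y :=
  ⟨F.src.comp φ h, F.tgt.comp φ (F.tgt_tgt.trans h), F.steps.map (fun W => W.rv φ.steps),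
    isChain_rv φ F.valid _ _⟩

end Cell3

/-- The free `3`-precategory on a `3`-prepolygraph. -/
def Pol3.free (P : Pol3) : Precat3 where
  C0 := P.P0
  C1 := P.Cell1
  C2 := Cell2 P.toPol2
  C3 := Cell3 P
  s1 := Chain.src
  t1 := Chain.tgt
  s2 := Chain.src
  t2 := Chain.tgt
  s1_t2 := Cell3.src_tgt
  t1_t2 := Cell3.tgt_tgt
  id1 _ := .nil
  id2 := Chain.id
  id3 := Chain.id
  comp0 := Quiver.Path.comp
  lw2 := Cell2.lw
  rw2 := Cell2.rw
  lw3 := Cell3.lw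
  rw3 := Cell3.rw
  comp1 := Chain.comp
  lv3 := Cell3.lv
  rv3 := Cell3.rv
  comp2 := Chain.comp
  s1_id2 _ := rfl
  t1_id2 _ := rfl
  s2_id3 _ := rfl
  t2_id3 _ := rfl
  s1_lw2 _ _ := rfl
  t1_lw2 _ _ := rfl
  s1_rw2 _ _ := rfl
  t1_rw2 _ _ := rfl
  s2_lw3 _ _ := rfl
  t2_lw3 _ _ := rfl
  s2_rw3 _ _ := rfl
  t2_rw3 _ _ := rfl
  s1_comp1 _ _ _ := rfl
  t1_comp1 _ _ _ := rfl
  s2_lv3 _ _ _ := rfl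
  t2_lv3 _ _ _ _ := rfl
  s2_rv3 _ _ _ := rfl
  t2_rv3 _ _ _ _ := rfl
  s2_comp2 _ _ _ := rfl
  t2_comp2 _ _ _ := rfl
  id1_comp0 := Quiver.Path.nil_comp
  comp0_id1 := Quiver.Path.comp_nil
  id1_lw2 := Cell2.lw_nil
  rw2_id1 := Cell2.rw_nil
  id1_lw3 F := by
    ext1
    · exact Cell2.lw_nil _
    · exact Cell2.lw_nil _
    · simp [Cell3.lw, Chain.map, Whisker3.lw_nil]
  rw3_id1 F := by
    ext1
    · exact Cell2.rw_nil _
    · exact Cell2.rw_nil _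
    · simp [Cell3.rw, Chain.map, Whisker3.rw, Whisker2.rw]
  lw2_id2 _ _ := rfl
  id2_rw2 _ _ := rfl
  lw3_id3 _ _ := rfl
  id3_rw3 _ _ := rfl
  id2_comp1 f φ h := by
    ext1
    · exact h
    · rfl
    · rfl
  comp1_id2 φ f h := by
    ext1
    · rfl
    · exact h.symm
    · simp [Chain.comp, Chain.id]
  id2_lv3 f F h := by
    have hs : f = F.src.src := h
    subst hs
    ext1
    · rfl
    · ext1
      · exact F.src_tgt.symm
      · rfl
      · rfl
    · exact List.map_id _
  rv3_id2 F f h := by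
    have hs : F.src.tgt = f := h
    subst hs
    ext1
    · ext1
      · rfl
      · rfl
      · simp [Cell3.rv, Chain.comp, Chain.id]
    · ext1
      · rfl
      · exact F.tgt_tgt.symm
      · simp [Cell3.rv, Chain.comp, Chain.id]
    · simp [Cell3.rv, Whisker3.rv, Chain.id]
  lv3_id3 _ _ _ _ := rfl
  id3_rv3 _ _ _ _ := rfl
  id3_comp2 φ F h := by
    ext1
    · exact h
    · rfl
    · rfl
  comp2_id3 F φ h := by
    ext1
    · rfl
    · exact h.symm
    · simp [Chain.comp, Chain.id]
  comp0_assoc := Quiver.Path.comp_assoc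
  lw2_comp0 := Cell2.lw_lw
  lw2_rw2 := Cell2.lw_rw
  rw2_comp0 := Cell2.rw_rw
  lw3_comp0 f g F := by
    ext1
    · exact Cell2.lw_lw _ _ _
    · exact Cell2.lw_lw _ _ _
    · simp [Cell3.lw, Chain.map, Whisker3.lw, Whisker2.lw, Quiver.Path.comp_assoc]
  lw3_rw3 f F g := by
    ext1
    · exact Cell2.lw_rw _ _ _
    · exact Cell2.lw_rw _ _ _
    · simp [Cell3.lw, Cell3.rw, Chain.map, Whisker3.lw, Whisker2.lw, Whisker3.rw, Whisker2.rw]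
  rw3_comp0 F f g := by
    ext1
    · exact Cell2.rw_rw _ _ _
    · exact Cell2.rw_rw _ _ _
    · simp [Cell3.rw, Chain.map, Whisker3.rw, Whisker2.rw, Quiver.Path.comp_assoc]
  comp1_assoc φ ψ χ h₁ h₂ h₃ h₄ := by
    ext1
    · rfl
    · rfl
    · simp [Chain.comp]
  lv3_comp1 φ ψ F h₁ h₂ h₃ h₄ := by
    ext1
    · ext1 <;> simp [Cell3.lv, Chain.comp]
    · ext1 <;> simp [Cell3.lv, Chain.comp]
    · simp [Cell3.lv, Chain.comp, Whisker3.lv]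
  lv3_rv3 φ F ψ h₁ h₂ h₃ h₄ := by
    ext1
    · ext1 <;> simp [Cell3.lv, Cell3.rv, Chain.comp]
    · ext1 <;> simp [Cell3.lv, Cell3.rv, Chain.comp]
    · simp [Cell3.lv, Cell3.rv, Whisker3.lv, Whisker3.rv]
  rv3_comp1 F φ ψ h₁ h₂ h₃ h₄ := by
    ext1
    · ext1 <;> simp [Cell3.rv, Chain.comp]
    · ext1 <;> simp [Cell3.rv, Chain.comp]
    · simp [Cell3.rv, Chain.comp, Whisker3.rv]
  comp2_assoc F G H h₁ h₂ h₃ h₄ := by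
    ext1
    · rfl
    · rfl
    · simp [Chain.comp]
  lw2_comp1 f φ ψ h h' := Cell2.lw_comp f φ ψ h h'
  rw2_comp1 φ ψ f h h' := Cell2.rw_comp φ ψ f h h'
  lw3_lv3 f φ F h h' := by
    ext1
    · exact Cell2.lw_comp _ _ _ h h'
    · have h'' := h.trans F.src_tgt.symm
      exact Cell2.lw_comp _ _ _ h'' (congrArg (fun g => Quiver.Path.comp f g) h'')
    · simp [Cell3.lv, Cell3.lw, Cell2.lw, Chain.map, Whisker3.lv, Whisker3.lw]
  lw3_rv3 f F φ h h' := by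
    ext1
    · exact Cell2.lw_comp _ _ _ h h'
    · have h'' := F.tgt_tgt.trans h
      exact Cell2.lw_comp _ _ _ h'' (congrArg (fun g => Quiver.Path.comp f g) h'')
    · simp [Cell3.rv, Cell3.lw, Cell2.lw, Chain.map, Whisker3.rv, Whisker3.lw]
  rw3_lv3 φ F f h h' := by
    ext1
    · exact Cell2.rw_comp _ _ _ h h'
    · have h'' := h.trans F.src_tgt.symm
      exact Cell2.rw_comp _ _ _ h'' (congrArg (fun g => Quiver.Path.comp g f) h'')
    · simp [Cell3.lv, Cell3.rw, Cell2.rw, Chain.map, Whisker3.lv, Whisker3.rw]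
  rw3_rv3 F φ f h h' := by
    ext1
    · exact Cell2.rw_comp _ _ _ h h'
    · have h'' := F.tgt_tgt.trans h
      exact Cell2.rw_comp _ _ _ h'' (congrArg (fun g => Quiver.Path.comp g f) h'')
    · simp [Cell3.rv, Cell3.rw, Cell2.rw, Chain.map, Whisker3.rv, Whisker3.rw]
  lw3_comp2 f F G h h' := by
    ext1 <;> simp [Cell3.lw, Chain.map, Chain.comp]
  rw3_comp2 F G f h h' := by
    ext1 <;> simp [Cell3.rw, Chain.map, Chain.comp]
  lv3_comp2 φ F G h₁ h₂ h₃ h₄ h₅ := by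
    ext1 <;> simp [Cell3.lv, Chain.comp]
  rv3_comp2 F G φ h₁ h₂ h₃ h₄ h₅ := by
    ext1 <;> simp [Cell3.rv, Chain.comp]

/-! ### Quotients of 3-precategories -/

namespace Precat3

/-- The smallest congruence on the `3`-cells of `C` that contains `R`. -/
inductive Congr (C : Precat3) (R : ∀ x y : C.C0, C.C3 x y → C.C3 x y → Prop) :
    ∀ {x y : C.C0}, C.C3 x y → C.C3 x y → Prop
  | of {x y : C.C0} {F G : C.C3 x y} : R x y F G → Congr C R F G
  | refl {x y : C.C0} (F : C.C3 x y) : Congr C R F F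
  | symm {x y : C.C0} {F G : C.C3 x y} : Congr C R F G → Congr C R G F
  | trans {x y : C.C0} {F G H : C.C3 x y} : Congr C R F G → Congr C R G H → Congr C R F H
  | lw3 {x y z : C.C0} (f : C.C1 x y) {F G : C.C3 y z} :
      Congr C R F G → Congr C R (C.lw3 f F) (C.lw3 f G)
  | rw3 {x y z : C.C0} {F G : C.C3 x y} (f : C.C1 y z) :
      Congr C R F G → Congr C R (C.rw3 F f) (C.rw3 G f)
  | lv3 {x y : C.C0} (φ : C.C2 x y) {F G : C.C3 x y} (h h') :
      Congr C R F G → Congr C R (C.lv3 φ F h) (C.lv3 φ G h')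
  | rv3 {x y : C.C0} {F G : C.C3 x y} (φ : C.C2 x y) (h h') :
      Congr C R F G → Congr C R (C.rv3 F φ h) (C.rv3 G φ h')
  | comp2 {x y : C.C0} {F F' G G' : C.C3 x y} (h₁ h₂) :
      Congr C R F F' → Congr C R G G' → Congr C R (C.comp2 F G h₁) (C.comp2 F' G' h₂)

/-- The congruence generated by `R`, as a setoid. -/
def congrSetoid (C : Precat3) (R : ∀ x y : C.C0, C.C3 x y → C.C3 x y → Prop) (x y : C.C0) :
    Setoid (C.C3 x y) :=
  ⟨Congr C R, Congr.refl, Congr.symm, Congr.trans⟩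

/-- A relation between parallel `3`-cells of `C`. -/
structure CellRel (C : Precat3) where
  rel : ∀ x y : C.C0, C.C3 x y → C.C3 x y → Prop
  src_eq {x y : C.C0} {F G : C.C3 x y} : rel x y F G → C.s2 F = C.s2 G
  tgt_eq {x y : C.C0} {F G : C.C3 x y} : rel x y F G → C.t2 F = C.t2 G

theorem Congr.parallel {C : Precat3} {R : CellRel C} {x y : C.C0} {F G : C.C3 x y}
    (h : Congr C R.rel F G) : C.s2 F = C.s2 G ∧ C.t2 F = C.t2 G := by
  induction h with
  | of h => exact ⟨R.src_eq h, R.tgt_eq h⟩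
  | refl => exact ⟨rfl, rfl⟩
  | symm _ ih => exact ⟨ih.1.symm, ih.2.symm⟩
  | trans _ _ ih ih' => exact ⟨ih.1.trans ih'.1, ih.2.trans ih'.2⟩
  | lw3 f _ ih => simp [C.s2_lw3, C.t2_lw3, ih.1, ih.2]
  | rw3 f _ ih => simp [C.s2_rw3, C.t2_rw3, ih.1, ih.2]
  | lv3 φ h h' _ ih =>
    refine ⟨by simp [C.s2_lv3, ih.1], ?_⟩
    rw [C.t2_lv3 _ _ h (by rw [C.s1_t2]; exact h), C.t2_lv3 _ _ h' (by rw [C.s1_t2]; exact h')]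
    simp [ih.2]
  | rv3 φ h h' _ ih =>
    refine ⟨by simp [C.s2_rv3, ih.1], ?_⟩
    rw [C.t2_rv3 _ _ h (by rw [C.t1_t2]; exact h), C.t2_rv3 _ _ h' (by rw [C.t1_t2]; exact h')]
    simp [ih.2]
  | comp2 h₁ h₂ _ _ ih₁ ih₂ => simp [C.s2_comp2, C.t2_comp2, ih₁.1, ih₂.2]

/-- The `3`-cells of `C` modulo the congruence generated by `R`. -/
def QCell (C : Precat3) (R : CellRel C) (x y : C.C0) : Type := Quotient (C.congrSetoid R.rel x y)

namespace QCell

variable {C : Precat3} {R : CellRel C} {x y z : C.C0}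

/-- The class of a `3`-cell. -/
def cls (R : CellRel C) (F : C.C3 x y) : QCell C R x y := Quotient.mk _ F

theorem ind {p : QCell C R x y → Prop} (h : ∀ F, p (cls R F)) (F : QCell C R x y) : p F :=
  Quotient.ind h F

theorem sound {F G : C.C3 x y} (h : Congr C R.rel F G) : cls R F = cls R G := Quotient.sound h

theorem cls_eq_iff {F G : C.C3 x y} : cls R F = cls R G ↔ Congr C R.rel F G :=
  ⟨fun h => Quotient.exact h, sound⟩

/-- A representative of a class; the operations on classes do not depend on this choice. -/
noncomputable def rep (F : QCell C R x y) : C.C3 x y := Quotient.out F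

theorem rep_cls (F : C.C3 x y) : Congr C R.rel (cls R F).rep F := cls_eq_iff.1 (Quotient.out_eq _)

def s2 (F : QCell C R x y) : C.C2 x y := Quotient.lift C.s2 (fun _ _ (h : Congr C R.rel _ _) => h.parallel.1) F

def t2 (F : QCell C R x y) : C.C2 x y := Quotient.lift C.t2 (fun _ _ (h : Congr C R.rel _ _) => h.parallel.2) F

theorem s2_cls (F : C.C3 x y) : (cls R F).s2 = C.s2 F := rfl

theorem t2_cls (F : C.C3 x y) : (cls R F).t2 = C.t2 F := rfl

theorem s2_rep (F : QCell C R x y) : C.s2 F.rep = F.s2 := congrArg s2 (Quotient.out_eq F)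

theorem t2_rep (F : QCell C R x y) : C.t2 F.rep = F.t2 := congrArg t2 (Quotient.out_eq F)

noncomputable def lw3 (f : C.C1 x y) (F : QCell C R y z) : QCell C R x z :=
  cls R (C.lw3 f F.rep)

noncomputable def rw3 (F : QCell C R x y) (f : C.C1 y z) : QCell C R x z :=
  cls R (C.rw3 F.rep f)

noncomputable def lv3 (φ : C.C2 x y) (F : QCell C R x y) (h : C.t1 φ = C.s1 F.s2) :
    QCell C R x y :=
  cls R (C.lv3 φ F.rep (by rw [s2_rep]; exact h))

noncomputable def rv3 (F : QCell C R x y) (φ : C.C2 x y) (h : C.t1 F.s2 = C.s1 φ) :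
    QCell C R x y :=
  cls R (C.rv3 F.rep φ (by rw [s2_rep]; exact h))

noncomputable def comp2 (F G : QCell C R x y) (h : F.t2 = G.s2) : QCell C R x y :=
  cls R (C.comp2 F.rep G.rep (by rw [s2_rep, t2_rep]; exact h))

theorem lw3_cls (f : C.C1 x y) (F : C.C3 y z) : lw3 f (cls R F) = cls R (C.lw3 f F) :=
  sound (Congr.lw3 f (rep_cls F))

theorem rw3_cls (F : C.C3 x y) (f : C.C1 y z) : rw3 (cls R F) f = cls R (C.rw3 F f) :=
  sound (Congr.rw3 f (rep_cls F))

theorem lv3_cls (φ : C.C2 x y) (F : C.C3 x y) (h : C.t1 φ = C.s1 (cls R F).s2) :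
    lv3 φ (cls R F) h = cls R (C.lv3 φ F h) :=
  sound (Congr.lv3 φ _ _ (rep_cls F))

theorem rv3_cls (F : C.C3 x y) (φ : C.C2 x y) (h : C.t1 (cls R F).s2 = C.s1 φ) :
    rv3 (cls R F) φ h = cls R (C.rv3 F φ h) :=
  sound (Congr.rv3 φ _ _ (rep_cls F))

theorem comp2_cls (F G : C.C3 x y) (h : (cls R F).t2 = (cls R G).s2) :
    comp2 (cls R F) (cls R G) h = cls R (C.comp2 F G h) :=
  sound (Congr.comp2 _ _ (rep_cls F) (rep_cls G))

end QCell

open QCell in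
/-- The quotient of `C` by the congruence on `3`-cells generated by `R`: the operations are those
of `C` on representatives. -/
noncomputable def quotient (C : Precat3) (R : CellRel C) : Precat3 where
  C0 := C.C0
  C1 := C.C1
  C2 := C.C2
  C3 := QCell C R
  s1 := C.s1
  t1 := C.t1
  s2 := QCell.s2
  t2 := QCell.t2
  s1_t2 := ind C.s1_t2
  t1_t2 := ind C.t1_t2
  id1 := C.id1
  id2 := C.id2
  id3 := fun φ => cls R (C.id3 φ)
  comp0 := C.comp0
  lw2 := C.lw2
  rw2 := C.rw2
  lw3 := QCell.lw3
  rw3 := QCell.rw3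
  comp1 := C.comp1
  lv3 := QCell.lv3
  rv3 := QCell.rv3
  comp2 := QCell.comp2
  s1_id2 := C.s1_id2
  t1_id2 := C.t1_id2
  s2_id3 := C.s2_id3
  t2_id3 := C.t2_id3
  s1_lw2 := C.s1_lw2
  t1_lw2 := C.t1_lw2
  s1_rw2 := C.s1_rw2
  t1_rw2 := C.t1_rw2
  s2_lw3 f := ind fun F => by rw [lw3_cls]; exact C.s2_lw3 f F
  t2_lw3 f := ind fun F => by rw [lw3_cls]; exact C.t2_lw3 f F
  s2_rw3 := ind fun F f => by rw [rw3_cls]; exact C.s2_rw3 F f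
  t2_rw3 := ind fun F f => by rw [rw3_cls]; exact C.t2_rw3 F f
  s1_comp1 := C.s1_comp1
  t1_comp1 := C.t1_comp1
  s2_lv3 φ := ind fun F h => by rw [lv3_cls]; exact C.s2_lv3 φ F h
  t2_lv3 φ := ind fun F h h' => by rw [lv3_cls]; exact C.t2_lv3 φ F h h'
  s2_rv3 := ind fun F φ h => by rw [rv3_cls]; exact C.s2_rv3 F φ h
  t2_rv3 := ind fun F φ h h' => by rw [rv3_cls]; exact C.t2_rv3 F φ h h'
  s2_comp2 := ind fun F => ind fun G h => by rw [comp2_cls]; exact C.s2_comp2 F G h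
  t2_comp2 := ind fun F => ind fun G h => by rw [comp2_cls]; exact C.t2_comp2 F G h
  id1_comp0 := C.id1_comp0
  comp0_id1 := C.comp0_id1
  id1_lw2 := C.id1_lw2
  rw2_id1 := C.rw2_id1
  id1_lw3 := ind fun F => by rw [lw3_cls, C.id1_lw3]
  rw3_id1 := ind fun F => by rw [rw3_cls, C.rw3_id1]
  lw2_id2 := C.lw2_id2
  id2_rw2 := C.id2_rw2
  lw3_id3 f φ := by rw [lw3_cls, C.lw3_id3]
  id3_rw3 φ f := by rw [rw3_cls, C.id3_rw3]
  id2_comp1 := C.id2_comp1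
  comp1_id2 := C.comp1_id2
  id2_lv3 f := ind fun F h => by rw [lv3_cls]; exact congrArg (cls R) (C.id2_lv3 _ _ _)
  rv3_id2 := ind fun F f h => by rw [rv3_cls]; exact congrArg (cls R) (C.rv3_id2 _ _ _)
  lv3_id3 φ ψ h h' := by rw [lv3_cls]; exact congrArg (cls R) (C.lv3_id3 _ _ _ _)
  id3_rv3 φ ψ h h' := by rw [rv3_cls]; exact congrArg (cls R) (C.id3_rv3 _ _ _ _)
  id3_comp2 φ := ind fun F h => by rw [comp2_cls]; exact congrArg (cls R) (C.id3_comp2 _ _ _)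
  comp2_id3 := ind fun F φ h => by rw [comp2_cls]; exact congrArg (cls R) (C.comp2_id3 _ _ _)
  comp0_assoc := C.comp0_assoc
  lw2_comp0 := C.lw2_comp0
  lw2_rw2 := C.lw2_rw2
  rw2_comp0 := C.rw2_comp0
  lw3_comp0 f g := ind fun F => by simp only [lw3_cls, C.lw3_comp0]
  lw3_rw3 f := ind fun F g => by simp only [lw3_cls, rw3_cls, C.lw3_rw3]
  rw3_comp0 := ind fun F f g => by simp only [rw3_cls, C.rw3_comp0]
  comp1_assoc := C.comp1_assoc
  lv3_comp1 φ ψ := ind fun F h₁ h₂ h₃ h₄ => by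
    simp only [lv3_cls] at *; exact congrArg (cls R) (C.lv3_comp1 _ _ _ _ _ _ _)
  lv3_rv3 φ := ind fun F ψ h₁ h₂ h₃ h₄ => by
    simp only [lv3_cls, rv3_cls] at *; exact congrArg (cls R) (C.lv3_rv3 _ _ _ _ _ _ _)
  rv3_comp1 := ind fun F φ ψ h₁ h₂ h₃ h₄ => by
    simp only [rv3_cls] at *; exact congrArg (cls R) (C.rv3_comp1 _ _ _ _ _ _ _)
  comp2_assoc := ind fun F => ind fun G => ind fun H h₁ h₂ h₃ h₄ => by
    simp only [comp2_cls] at *; exact congrArg (cls R) (C.comp2_assoc _ _ _ _ _ _ _)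
  lw2_comp1 := C.lw2_comp1
  rw2_comp1 := C.rw2_comp1
  lw3_lv3 f φ := ind fun F h h' => by
    simp only [lw3_cls, lv3_cls] at *; exact congrArg (cls R) (C.lw3_lv3 _ _ _ _ _)
  lw3_rv3 f := ind fun F φ h h' => by
    simp only [lw3_cls, rv3_cls] at *; exact congrArg (cls R) (C.lw3_rv3 _ _ _ _ _)
  rw3_lv3 φ := ind fun F f h h' => by
    simp only [rw3_cls, lv3_cls] at *; exact congrArg (cls R) (C.rw3_lv3 _ _ _ _ _)
  rw3_rv3 := ind fun F φ f h h' => by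
    simp only [rw3_cls, rv3_cls] at *; exact congrArg (cls R) (C.rw3_rv3 _ _ _ _ _)
  lw3_comp2 f := ind fun F => ind fun G h h' => by
    simp only [lw3_cls, comp2_cls] at *; exact congrArg (cls R) (C.lw3_comp2 _ _ _ _ _)
  rw3_comp2 := ind fun F => ind fun G f h h' => by
    simp only [rw3_cls, comp2_cls] at *; exact congrArg (cls R) (C.rw3_comp2 _ _ _ _ _)
  lv3_comp2 φ := ind fun F => ind fun G h₁ h₂ h₃ h₄ h₅ => by
    simp only [lv3_cls, comp2_cls] at *; exact congrArg (cls R) (C.lv3_comp2 _ _ _ _ _ _ _ _)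
  rv3_comp2 := ind fun F => ind fun G φ h₁ h₂ h₃ h₄ h₅ => by
    simp only [rv3_cls, comp2_cls] at *; exact congrArg (cls R) (C.rv3_comp2 _ _ _ _ _ _ _ _)

end Precat3

/-! ### Localization -/

namespace Precat3

section Zigzag

variable {C : Precat3} {x y z : C.C0}

/-- The signed `3`-cell `(F, true)`, written `F⁺`, goes from the source to the target of `F`, and
`(F, false)`, written `F⁻`, goes from the target to the source of `F`. -/
def SignedStep (e : C.C3 x y × Bool) (φ ψ : C.C2 x y) : Prop :=
  match e with
  | (F, true) => φ = C.s2 F ∧ ψ = C.t2 F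
  | (F, false) => φ = C.t2 F ∧ ψ = C.s2 F

/-- The zigzags of `3`-cells of `C`: composable lists of signed `3`-cells. -/
abbrev Zigzag (C : Precat3) (x y : C.C0) : Type := Chain (SignedStep (C := C) (x := x) (y := y))

theorem SignedStep.s1_eq {e : C.C3 x y × Bool} {φ ψ : C.C2 x y} (h : SignedStep e φ ψ) :
    C.s1 φ = C.s1 (C.s2 e.1) ∧ C.s1 ψ = C.s1 (C.s2 e.1) := by
  obtain ⟨F, _ | _⟩ := e <;> obtain ⟨rfl, rfl⟩ := h <;> simp [C.s1_t2]

theorem SignedStep.t1_eq {e : C.C3 x y × Bool} {φ ψ : C.C2 x y} (h : SignedStep e φ ψ) :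
    C.t1 φ = C.t1 (C.s2 e.1) ∧ C.t1 ψ = C.t1 (C.s2 e.1) := by
  obtain ⟨F, _ | _⟩ := e <;> obtain ⟨rfl, rfl⟩ := h <;> simp [C.t1_t2]

namespace Zigzag

theorem s1_aux {φ ψ : C.C2 x y} {es : List (C.C3 x y × Bool)} (h : IsChain SignedStep φ es ψ) :
    C.s1 ψ = C.s1 φ ∧ ∀ e ∈ es, C.s1 (C.s2 e.1) = C.s1 φ := by
  induction es generalizing φ with
  | nil => cases h; simp
  | cons e es ih =>
    obtain ⟨χ, h, h'⟩ := h
    have h1 := h.s1_eq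
    have h2 := ih h'
    refine ⟨by rw [h2.1, h1.1, h1.2], ?_⟩
    intro d hd
    rcases List.mem_cons.1 hd with rfl | hd
    · exact h1.1.symm
    · rw [h2.2 d hd, h1.1, h1.2]

theorem t1_aux {φ ψ : C.C2 x y} {es : List (C.C3 x y × Bool)} (h : IsChain SignedStep φ es ψ) :
    C.t1 ψ = C.t1 φ ∧ ∀ e ∈ es, C.t1 (C.s2 e.1) = C.t1 φ := by
  induction es generalizing φ with
  | nil => cases h; simp
  | cons e es ih =>
    obtain ⟨χ, h, h'⟩ := h
    have h1 := h.t1_eq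
    have h2 := ih h'
    refine ⟨by rw [h2.1, h1.1, h1.2], ?_⟩
    intro d hd
    rcases List.mem_cons.1 hd with rfl | hd
    · exact h1.1.symm
    · rw [h2.2 d hd, h1.1, h1.2]

theorem step_lw (f : C.C1 x y) (e : C.C3 y z × Bool) (φ ψ : C.C2 y z) (h : SignedStep e φ ψ) :
    SignedStep (C.lw3 f e.1, e.2) (C.lw2 f φ) (C.lw2 f ψ) := by
  obtain ⟨F, _ | _⟩ := e <;> obtain ⟨rfl, rfl⟩ := h <;>
    simp [SignedStep, C.s2_lw3, C.t2_lw3]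

theorem step_rw (f : C.C1 y z) (e : C.C3 x y × Bool) (φ ψ : C.C2 x y) (h : SignedStep e φ ψ) :
    SignedStep (C.rw3 e.1 f, e.2) (C.rw2 φ f) (C.rw2 ψ f) := by
  obtain ⟨F, _ | _⟩ := e <;> obtain ⟨rfl, rfl⟩ := h <;>
    simp [SignedStep, C.s2_rw3, C.t2_rw3]

theorem isChain_lv (χ : C.C2 x y) {φ ψ : C.C2 x y} {es : List (C.C3 x y × Bool)}
    (h : IsChain SignedStep φ es ψ) (hφ : C.t1 χ = C.s1 φ) (hψ : C.t1 χ = C.s1 ψ)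
    (H : ∀ e ∈ es, C.t1 χ = C.s1 (C.s2 e.1)) :
    IsChain SignedStep (C.comp1 χ φ hφ) (es.pmap (fun e he => (C.lv3 χ e.1 he, e.2)) H)
      (C.comp1 χ ψ hψ) := by
  induction es generalizing φ with
  | nil => cases h; rfl
  | cons e es ih =>
    obtain ⟨d, hd, h⟩ := h
    have hχ : C.t1 χ = C.s1 d := by rw [hφ, hd.s1_eq.1, hd.s1_eq.2]
    refine ⟨C.comp1 χ d hχ, ?_, ih h hχ _⟩
    obtain ⟨F, _ | _⟩ := e <;> obtain ⟨rfl, rfl⟩ := hd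
    · exact ⟨(C.t2_lv3 _ _ _ _).symm, (C.s2_lv3 _ _ _).symm⟩
    · exact ⟨(C.s2_lv3 _ _ _).symm, (C.t2_lv3 _ _ _ _).symm⟩

theorem isChain_rv (χ : C.C2 x y) {φ ψ : C.C2 x y} {es : List (C.C3 x y × Bool)}
    (h : IsChain SignedStep φ es ψ) (hφ : C.t1 φ = C.s1 χ) (hψ : C.t1 ψ = C.s1 χ)
    (H : ∀ e ∈ es, C.t1 (C.s2 e.1) = C.s1 χ) :
    IsChain SignedStep (C.comp1 φ χ hφ) (es.pmap (fun e he => (C.rv3 e.1 χ he, e.2)) H)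
      (C.comp1 ψ χ hψ) := by
  induction es generalizing φ with
  | nil => cases h; rfl
  | cons e es ih =>
    obtain ⟨d, hd, h⟩ := h
    have hχ : C.t1 d = C.s1 χ := by rw [← hφ, hd.t1_eq.1, hd.t1_eq.2]
    refine ⟨C.comp1 d χ hχ, ?_, ih h hχ _⟩
    obtain ⟨F, _ | _⟩ := e <;> obtain ⟨rfl, rfl⟩ := hd
    · exact ⟨(C.t2_rv3 _ _ _ _).symm, (C.s2_rv3 _ _ _).symm⟩
    · exact ⟨(C.s2_rv3 _ _ _).symm, (C.t2_rv3 _ _ _ _).symm⟩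

/-- `f ∘₀ (F₁, …, Fₖ) = (f ∘₀ F₁, …, f ∘₀ Fₖ)` -/
def lw (f : C.C1 x y) (F : Zigzag C y z) : Zigzag C x z :=
  F.map (C.lw2 f) (fun e => (C.lw3 f e.1, e.2)) (step_lw f)

/-- `(F₁, …, Fₖ) ∘₀ f = (F₁ ∘₀ f, …, Fₖ ∘₀ f)` -/
def rw (F : Zigzag C x y) (f : C.C1 y z) : Zigzag C x z :=
  F.map (fun φ => C.rw2 φ f) (fun e => (C.rw3 e.1 f, e.2)) (step_rw f)

/-- `φ ∘₁ (F₁, …, Fₖ) = (φ ∘₁ F₁, …, φ ∘₁ Fₖ)` -/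
def lv (φ : C.C2 x y) (F : Zigzag C x y) (h : C.t1 φ = C.s1 F.src) : Zigzag C x y :=
  ⟨C.comp1 φ F.src h, C.comp1 φ F.tgt (h.trans (s1_aux F.valid).1.symm),
    F.steps.pmap (fun e he => (C.lv3 φ e.1 he, e.2))
      (fun e he => h.trans ((s1_aux F.valid).2 e he).symm),
    isChain_lv φ F.valid _ _ _⟩

/-- `(F₁, …, Fₖ) ∘₁ φ = (F₁ ∘₁ φ, …, Fₖ ∘₁ φ)` -/
def rv (F : Zigzag C x y) (φ : C.C2 x y) (h : C.t1 F.src = C.s1 φ) : Zigzag C x y :=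
  ⟨C.comp1 F.src φ h, C.comp1 F.tgt φ ((t1_aux F.valid).1.trans h),
    F.steps.pmap (fun e he => (C.rv3 e.1 φ he, e.2))
      (fun e he => ((t1_aux F.valid).2 e he).trans h),
    isChain_rv φ F.valid _ _ _⟩

end Zigzag

end Zigzag

theorem pmap_eq_self' {α : Type} {p : α → Prop} {f : ∀ a, p a → α}
    {l : List α} (H : ∀ a ∈ l, p a) (h : ∀ a ha, f a ha = a) : l.pmap f H = l := by
  induction l with
  | nil => rfl
  | cons a l ih => simp [h, ih]

theorem pmap_pmap_eq {α : Type} {p q r : α → Prop} {f : ∀ a, p a → α} {g : ∀ a, q a → α}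
    {k : ∀ a, r a → α} {l : List α} (H₁ : ∀ a ∈ l, p a) (H₂ : ∀ a ∈ l.pmap f H₁, q a)
    (H₃ : ∀ a ∈ l, r a) (h : ∀ a h₁ h₂ h₃, g (f a h₁) h₂ = k a h₃) :
    (l.pmap f H₁).pmap g H₂ = l.pmap k H₃ := by
  induction l with
  | nil => rfl
  | cons a l ih =>
    simp only [List.pmap_cons, h a _ _ (H₃ a (by simp))]
    exact congrArg _ (ih _ _ _)

/-- The `3`-precategory of zigzags of `C`: it has the same `0`-, `1`- and `2`-cells as `C`. -/
def zigzag (C : Precat3) : Precat3 where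
  C0 := C.C0
  C1 := C.C1
  C2 := C.C2
  C3 := C.Zigzag
  s1 := C.s1
  t1 := C.t1
  s2 := Chain.src
  t2 := Chain.tgt
  s1_t2 F := (Zigzag.s1_aux F.valid).1
  t1_t2 F := (Zigzag.t1_aux F.valid).1
  id1 := C.id1
  id2 := C.id2
  id3 := Chain.id
  comp0 := C.comp0
  lw2 := C.lw2
  rw2 := C.rw2
  lw3 := Zigzag.lw
  rw3 := Zigzag.rw
  comp1 := C.comp1
  lv3 := Zigzag.lv
  rv3 := Zigzag.rv
  comp2 := Chain.comp
  s1_id2 := C.s1_id2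
  t1_id2 := C.t1_id2
  s2_id3 _ := rfl
  t2_id3 _ := rfl
  s1_lw2 := C.s1_lw2
  t1_lw2 := C.t1_lw2
  s1_rw2 := C.s1_rw2
  t1_rw2 := C.t1_rw2
  s2_lw3 _ _ := rfl
  t2_lw3 _ _ := rfl
  s2_rw3 _ _ := rfl
  t2_rw3 _ _ := rfl
  s1_comp1 := C.s1_comp1
  t1_comp1 := C.t1_comp1
  s2_lv3 _ _ _ := rfl
  t2_lv3 _ _ _ _ := rfl
  s2_rv3 _ _ _ := rfl
  t2_rv3 _ _ _ _ := rfl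
  s2_comp2 _ _ _ := rfl
  t2_comp2 _ _ _ := rfl
  id1_comp0 := C.id1_comp0
  comp0_id1 := C.comp0_id1
  id1_lw2 := C.id1_lw2
  rw2_id1 := C.rw2_id1
  id1_lw3 F := by ext1 <;> simp [Zigzag.lw, Chain.map, C.id1_lw2, C.id1_lw3]
  rw3_id1 F := by ext1 <;> simp [Zigzag.rw, Chain.map, C.rw2_id1, C.rw3_id1]
  lw2_id2 := C.lw2_id2
  id2_rw2 := C.id2_rw2
  lw3_id3 _ _ := rfl
  id3_rw3 _ _ := rfl
  id2_comp1 := C.id2_comp1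
  comp1_id2 := C.comp1_id2
  id2_lv3 f F h := by
    ext1
    · exact C.id2_comp1 _ _ _
    · exact C.id2_comp1 _ _ _
    · exact pmap_eq_self' _ fun e he => by simp [C.id2_lv3]
  rv3_id2 F f h := by
    ext1
    · exact C.comp1_id2 _ _ _
    · exact C.comp1_id2 _ _ _
    · exact pmap_eq_self' _ fun e he => by simp [C.rv3_id2]
  lv3_id3 _ _ _ _ := rfl
  id3_rv3 _ _ _ _ := rfl
  id3_comp2 φ F h := by
    ext1
    · exact h
    · rfl
    · rfl
  comp2_id3 F φ h := by
    ext1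
    · rfl
    · exact h.symm
    · simp [Chain.comp, Chain.id]
  comp0_assoc := C.comp0_assoc
  lw2_comp0 := C.lw2_comp0
  lw2_rw2 := C.lw2_rw2
  rw2_comp0 := C.rw2_comp0
  lw3_comp0 f g F := by ext1 <;> simp [Zigzag.lw, Chain.map, C.lw2_comp0, C.lw3_comp0]
  lw3_rw3 f F g := by ext1 <;> simp [Zigzag.lw, Zigzag.rw, Chain.map, C.lw2_rw2, C.lw3_rw3]
  rw3_comp0 F f g := by ext1 <;> simp [Zigzag.rw, Chain.map, C.rw2_comp0, C.rw3_comp0]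
  comp1_assoc := C.comp1_assoc
  lv3_comp1 φ ψ F h₁ h₂ h₃ h₄ := by
    ext1
    · exact C.comp1_assoc _ _ _ _ _ _ _
    · exact C.comp1_assoc _ _ _ _ _ _ _
    · symm
      exact pmap_pmap_eq _ _ _ fun e _ _ _ => congrArg (·, e.2) (C.lv3_comp1 _ _ _ _ _ _ _).symm
  lv3_rv3 φ F ψ h₁ h₂ h₃ h₄ := by
    ext1
    · exact C.comp1_assoc _ _ _ _ _ _ _
    · exact C.comp1_assoc _ _ _ _ _ _ _
    · simp only [Zigzag.lv, Zigzag.rv, List.pmap_pmap]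
      exact List.pmap_congr_left _ fun e he h h' => Prod.ext (C.lv3_rv3 _ _ _ _ _ _ _) rfl
  rv3_comp1 F φ ψ h₁ h₂ h₃ h₄ := by
    ext1
    · exact C.comp1_assoc _ _ _ _ _ _ _
    · exact C.comp1_assoc _ _ _ _ _ _ _
    · exact pmap_pmap_eq _ _ _ fun e _ _ _ => congrArg (·, e.2) (C.rv3_comp1 _ _ _ _ _ _ _)
  comp2_assoc F G H h₁ h₂ h₃ h₄ := by
    ext1
    · rfl
    · rfl
    · simp [Chain.comp]
  lw2_comp1 := C.lw2_comp1
  rw2_comp1 := C.rw2_comp1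
  lw3_lv3 f φ F h h' := by
    ext1
    · exact C.lw2_comp1 _ _ _ _ _
    · exact C.lw2_comp1 _ _ _ _ _
    · simp only [Zigzag.lw, Zigzag.lv, Chain.map, List.map_pmap, List.pmap_map]
      exact List.pmap_congr_left _ fun e he h h' => Prod.ext (C.lw3_lv3 _ _ _ _ _) rfl
  lw3_rv3 f F φ h h' := by
    ext1
    · exact C.lw2_comp1 _ _ _ _ _
    · exact C.lw2_comp1 _ _ _ _ _
    · simp only [Zigzag.lw, Zigzag.rv, Chain.map, List.map_pmap, List.pmap_map]
      exact List.pmap_congr_left _ fun e he h h' => Prod.ext (C.lw3_rv3 _ _ _ _ _) rfl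
  rw3_lv3 φ F f h h' := by
    ext1
    · exact C.rw2_comp1 _ _ _ _ _
    · exact C.rw2_comp1 _ _ _ _ _
    · simp only [Zigzag.rw, Zigzag.lv, Chain.map, List.map_pmap, List.pmap_map]
      exact List.pmap_congr_left _ fun e he h h' => Prod.ext (C.rw3_lv3 _ _ _ _ _) rfl
  rw3_rv3 F φ f h h' := by
    ext1
    · exact C.rw2_comp1 _ _ _ _ _
    · exact C.rw2_comp1 _ _ _ _ _
    · simp only [Zigzag.rw, Zigzag.rv, Chain.map, List.map_pmap, List.pmap_map]
      exact List.pmap_congr_left _ fun e he h h' => Prod.ext (C.rw3_rv3 _ _ _ _ _) rfl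
  lw3_comp2 f F G h h' := by ext1 <;> simp [Zigzag.lw, Chain.map, Chain.comp]
  rw3_comp2 F G f h h' := by ext1 <;> simp [Zigzag.rw, Chain.map, Chain.comp]
  lv3_comp2 φ F G h₁ h₂ h₃ h₄ h₅ := by
    ext1 <;> simp [Zigzag.lv, Chain.comp]
  rv3_comp2 F G φ h₁ h₂ h₃ h₄ h₅ := by
    ext1 <;> simp [Zigzag.rv, Chain.comp]

/-- The elementary simplifications of lists of signed `3`-cells: deletion of an identity,
composition of two consecutive cells of the same sign, cancellation of two consecutive occurrences
of the same cell with opposite signs. -/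
inductive ZigzagRule (C : Precat3) (x y : C.C0) :
    List (C.C3 x y × Bool) → List (C.C3 x y × Bool) → Prop
  | unit (as bs : List (C.C3 x y × Bool)) (φ : C.C2 x y) (ε : Bool) :
      ZigzagRule C x y (as ++ (C.id3 φ, ε) :: bs) (as ++ bs)
  | pos (as bs : List (C.C3 x y × Bool)) (F G : C.C3 x y) (h : C.t2 F = C.s2 G) :
      ZigzagRule C x y (as ++ (F, true) :: (G, true) :: bs) (as ++ (C.comp2 F G h, true) :: bs)
  | neg (as bs : List (C.C3 x y × Bool)) (F G : C.C3 x y) (h : C.t2 G = C.s2 F) :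
      ZigzagRule C x y (as ++ (F, false) :: (G, false) :: bs) (as ++ (C.comp2 G F h, false) :: bs)
  | cancel (as bs : List (C.C3 x y × Bool)) (F : C.C3 x y) (ε : Bool) :
      ZigzagRule C x y (as ++ (F, ε) :: (F, !ε) :: bs) (as ++ bs)

/-- Two parallel zigzags related by an elementary simplification. -/
def zigzagRel (C : Precat3) : CellRel C.zigzag where
  rel x y (F G : C.Zigzag x y) :=
    F.src = G.src ∧ F.tgt = G.tgt ∧ ZigzagRule C x y F.steps G.steps
  src_eq h := h.1
  tgt_eq h := h.2.1

/-- The localization of `C` at its `3`-cells: the `(3,2)`-precategory of zigzags of `C` modulo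
elementary simplifications. -/
noncomputable def localization (C : Precat3) : Precat3 := C.zigzag.quotient C.zigzagRel

end Precat3

/-! ### Gray presentations -/

/-- A `4`-prepolygraph: a `3`-prepolygraph and `4`-generators between parallel `3`-cells. -/
structure Pol4 extends Pol3 where
  P4 : P0 → P0 → Type
  src4 {x y : P0} : P4 x y → Cell3 toPol3 x y
  tgt4 {x y : P0} : P4 x y → Cell3 toPol3 x y
  src_tgt4 {x y : P0} (G : P4 x y) : (tgt4 G).src = (src4 G).src
  tgt_tgt4 {x y : P0} (G : P4 x y) : (tgt4 G).tgt = (src4 G).tgt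

/-- The source and the target of a `4`-generator are related. -/
def Pol4.rel (P : Pol4) : Precat3.CellRel P.toPol3.free where
  rel x y F G := ∃ A : P.P4 x y, F = P.src4 A ∧ G = P.tgt4 A
  src_eq := by rintro x y _ _ ⟨A, rfl, rfl⟩; exact (P.src_tgt4 A).symm
  tgt_eq := by rintro x y _ _ ⟨A, rfl, rfl⟩; exact (P.tgt_tgt4 A).symm

/-- The `3`-precategory presented by a `4`-prepolygraph `P`: the free `3`-precategory on the
generators of dimension at most `3`, modulo the congruence generated by the `4`-generators. -/
noncomputable def Pol4.presented (P : Pol4) : Precat3 := P.toPol3.free.quotient P.rel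

namespace Cell2

variable {P : Pol2} {x y z : P.P0}

/-- `(φ ∘₀ g) ∘₁ (f' ∘₀ ψ)` for `φ : f ⇒ f'` and `ψ : g ⇒ g'`: first `φ`, then `ψ`. -/
def leftFirst (φ : Cell2 P x y) (ψ : Cell2 P y z) : Cell2 P x z :=
  (φ.rw ψ.src).comp (lw φ.tgt ψ) rfl

/-- `(f ∘₀ ψ) ∘₁ (φ ∘₀ g')` for `φ : f ⇒ f'` and `ψ : g ⇒ g'`: first `ψ`, then `φ`. -/
def rightFirst (φ : Cell2 P x y) (ψ : Cell2 P y z) : Cell2 P x z :=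
  (lw φ.src ψ).comp (φ.rw ψ.tgt) rfl

end Cell2

/-- Interchange generators `X_{α,g,β}` in a `3`-prepolygraph, of type
`(α ∘₀ g ∘₀ h) ∘₁ (f' ∘₀ g ∘₀ β) ⇛ (f ∘₀ g ∘₀ β) ∘₁ (α ∘₀ g ∘₀ h')` for `0`-composable
`2`-generators `α : f ⇒ f'`, `β : h ⇒ h'` and a `1`-cell `g`. -/
structure Interchange (P : Pol3) where
  X {x x' y' y : P.P0} (α : P.P2 x x') (g : P.Cell1 x' y') (β : P.P2 y' y) : P.P3 x y
  src_X {x x' y' y : P.P0} (α : P.P2 x x') (g : P.Cell1 x' y') (β : P.P2 y' y) :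
    P.src3 (X α g β) = (Cell2.gen α).leftFirst ((Cell2.gen β).lw g)
  tgt_X {x x' y' y : P.P0} (α : P.P2 x x') (g : P.Cell1 x' y') (β : P.P2 y' y) :
    P.tgt3 (X α g β) = (Cell2.gen α).rightFirst ((Cell2.gen β).lw g)

namespace Interchange

variable {P : Pol3} (I : Interchange P) {x y z : P.P0}

/-- The rewriting steps moving the whisker `w` of `2`-cells downwards through the whiskers
`w₁, …, wₖ`, in this order. -/
def stepsOne (w : Whisker2 P.toPol2 x y) : List (Whisker2 P.toPol2 y z) → List (Whisker3 P x z)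
  | [] => []
  | v :: vs =>
    ⟨[], w.l, I.X w.α (w.r.comp v.l) v.α, v.r, vs.map (Whisker2.lw w.tgt)⟩ ::
      (stepsOne w vs).map (Whisker3.lv [v.lw w.src])

/-- The rewriting steps of the standard path defining `X_{φ,ψ}`, where `ws` and `vs` are the
whiskers of `φ` and `ψ`, and `g` and `g'` are the source and the target of `ψ`: the last whisker
of `φ` is moved through all the whiskers of `ψ`, then the last but one, and so on. -/
def steps (g g' : P.Cell1 y z) (vs : List (Whisker2 P.toPol2 y z)) :
    List (Whisker2 P.toPol2 x y) → List (Whisker3 P x z)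
  | [] => []
  | w :: ws =>
    (steps g g' vs ws).map (Whisker3.lv [w.rw g]) ++
      (I.stepsOne w vs).map (fun W => W.rv (ws.map (fun w' => w'.rw g')))

theorem step_X (w : Whisker2 P.toPol2 x y) (v : Whisker2 P.toPol2 y z) :
    Whisker3.Step ⟨[], w.l, I.X w.α (w.r.comp v.l) v.α, v.r, []⟩
      ((Cell2.ofWhisker w).leftFirst (Cell2.ofWhisker v))
      ((Cell2.ofWhisker w).rightFirst (Cell2.ofWhisker v)) := by
  have hs : Whisker3.midSrc ⟨[], w.l, I.X w.α (w.r.comp v.l) v.α, v.r, []⟩ =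
      (Cell2.ofWhisker w).leftFirst (Cell2.ofWhisker v) := by
    simp only [Whisker3.midSrc, I.src_X]
    ext1 <;> simp [Cell2.lw, Cell2.rw, Cell2.leftFirst, Cell2.ofWhisker, Cell2.gen, Chain.map,
      Chain.comp, Chain.single, Whisker2.lw, Whisker2.rw, Whisker2.src, Whisker2.tgt,
      Quiver.Path.comp_assoc]
  have ht : Whisker3.midTgt ⟨[], w.l, I.X w.α (w.r.comp v.l) v.α, v.r, []⟩ =
      (Cell2.ofWhisker w).rightFirst (Cell2.ofWhisker v) := by
    simp only [Whisker3.midTgt, I.tgt_X]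
    ext1 <;> simp [Cell2.lw, Cell2.rw, Cell2.rightFirst, Cell2.ofWhisker, Cell2.gen, Chain.map,
      Chain.comp, Chain.single, Whisker2.lw, Whisker2.rw, Whisker2.src, Whisker2.tgt,
      Quiver.Path.comp_assoc]
  exact Whisker3.step_of_mid rfl rfl hs ht rfl rfl

theorem isChain_stepsOne (w : Whisker2 P.toPol2 x y) (vs : List (Whisker2 P.toPol2 y z))
    (g g' : P.Cell1 y z) (hv : IsChain Whisker2.Step g vs g') :
    IsChain Whisker3.Step ((Cell2.ofWhisker w).leftFirst ⟨g, g', vs, hv⟩) (I.stepsOne w vs)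
      ((Cell2.ofWhisker w).rightFirst ⟨g, g', vs, hv⟩) := by
  induction vs generalizing g with
  | nil =>
    cases hv
    change _ = _
    ext1 <;> simp [Cell2.lw, Cell2.rw, Cell2.leftFirst, Cell2.rightFirst, Cell2.ofWhisker,
      Chain.map, Chain.comp, Chain.single]
  | cons v vs ih =>
    obtain ⟨c, ⟨rfl, rfl⟩, hv'⟩ := hv
    refine ⟨((Cell2.ofWhisker w).rightFirst (Cell2.ofWhisker v)).comp
      (Cell2.lw w.tgt ⟨v.tgt, g', vs, hv'⟩) rfl, ?_, ?_⟩
    · have h := Whisker3.step_rv (Cell2.lw w.tgt ⟨v.tgt, g', vs, hv'⟩) _ _ _ (I.step_X w v) rfl rfl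
      have e : (Cell2.ofWhisker w).leftFirst ⟨v.src, g', v :: vs, ⟨_, ⟨rfl, rfl⟩, hv'⟩⟩ =
          ((Cell2.ofWhisker w).leftFirst (Cell2.ofWhisker v)).comp
            (Cell2.lw w.tgt ⟨v.tgt, g', vs, hv'⟩) rfl := by
        ext1 <;> simp [Cell2.lw, Cell2.rw, Cell2.leftFirst, Cell2.ofWhisker,
          Chain.map, Chain.comp, Chain.single]
      rw [e]
      exact h
    · have h := Cell3.isChain_lv (Cell2.lw w.src (Cell2.ofWhisker v)) (ih _ hv') rfl rfl
      have e₁ : ((Cell2.ofWhisker w).rightFirst (Cell2.ofWhisker v)).comp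
          (Cell2.lw w.tgt ⟨v.tgt, g', vs, hv'⟩) rfl =
          Chain.comp (Cell2.lw w.src (Cell2.ofWhisker v))
            ((Cell2.ofWhisker w).leftFirst ⟨v.tgt, g', vs, hv'⟩) rfl := by
        ext1 <;> simp [Cell2.lw, Cell2.rw, Cell2.leftFirst, Cell2.rightFirst, Cell2.ofWhisker,
          Chain.map, Chain.comp, Chain.single]
      have e₂ : (Cell2.ofWhisker w).rightFirst ⟨v.src, g', v :: vs, ⟨_, ⟨rfl, rfl⟩, hv'⟩⟩ =
          Chain.comp (Cell2.lw w.src (Cell2.ofWhisker v))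
            ((Cell2.ofWhisker w).rightFirst ⟨v.tgt, g', vs, hv'⟩) rfl := by
        ext1 <;> simp [Cell2.lw, Cell2.rw, Cell2.rightFirst, Cell2.ofWhisker,
          Chain.map, Chain.comp, Chain.single]
      rw [e₁, e₂]
      exact h

theorem isChain_steps (ψ : Cell2 P.toPol2 y z) (ws : List (Whisker2 P.toPol2 x y))
    (f f' : P.Cell1 x y) (hw : IsChain Whisker2.Step f ws f') :
    IsChain Whisker3.Step (Cell2.leftFirst ⟨f, f', ws, hw⟩ ψ) (I.steps ψ.src ψ.tgt ψ.steps ws)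
      (Cell2.rightFirst ⟨f, f', ws, hw⟩ ψ) := by
  induction ws generalizing f with
  | nil =>
    cases hw
    change _ = _
    ext1 <;> simp [Cell2.lw, Cell2.rw, Cell2.leftFirst, Cell2.rightFirst, Chain.map, Chain.comp]
  | cons w ws ih =>
    obtain ⟨c, ⟨rfl, rfl⟩, hw'⟩ := hw
    have h₁ := Cell3.isChain_lv (Cell2.rw (Cell2.ofWhisker w) ψ.src) (ih _ hw') rfl rfl
    have h₂ := Cell3.isChain_rv (Cell2.rw ⟨w.tgt, f', ws, hw'⟩ ψ.tgt)
      (I.isChain_stepsOne w ψ.steps ψ.src ψ.tgt ψ.valid) rfl rfl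
    have e : Chain.comp (Cell2.rw (Cell2.ofWhisker w) ψ.src)
        (Cell2.rightFirst ⟨w.tgt, f', ws, hw'⟩ ψ) rfl =
        Chain.comp ((Cell2.ofWhisker w).leftFirst ψ)
          (Cell2.rw ⟨w.tgt, f', ws, hw'⟩ ψ.tgt) rfl := by
      ext1 <;> simp [Cell2.lw, Cell2.rw, Cell2.leftFirst, Cell2.rightFirst, Cell2.ofWhisker,
          Chain.map, Chain.comp, Chain.single]
    rw [e] at h₁
    have h := h₁.append h₂
    have e₁ : Cell2.leftFirst ⟨w.src, f', w :: ws, ⟨_, ⟨rfl, rfl⟩, hw'⟩⟩ ψ =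
        Chain.comp (Cell2.rw (Cell2.ofWhisker w) ψ.src)
          (Cell2.leftFirst ⟨w.tgt, f', ws, hw'⟩ ψ) rfl := by
      ext1 <;> simp [Cell2.lw, Cell2.rw, Cell2.leftFirst, Cell2.ofWhisker,
        Chain.map, Chain.comp, Chain.single]
    have e₂ : Cell2.rightFirst ⟨w.src, f', w :: ws, ⟨_, ⟨rfl, rfl⟩, hw'⟩⟩ ψ =
        Chain.comp ((Cell2.ofWhisker w).rightFirst ψ)
          (Cell2.rw ⟨w.tgt, f', ws, hw'⟩ ψ.tgt) rfl := by
      ext1 <;> simp [Cell2.lw, Cell2.rw, Cell2.rightFirst, Cell2.ofWhisker,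
        Chain.map, Chain.comp, Chain.single]
    rw [e₁, e₂]
    exact h

/-- The `3`-cell `X_{φ,ψ} : (φ ∘₀ g) ∘₁ (f' ∘₀ ψ) ⇛ (f ∘₀ ψ) ∘₁ (φ ∘₀ g')` for `0`-composable
`2`-cells `φ : f ⇒ f'` and `ψ : g ⇒ g'`, a composite of interchange generators in context. -/
def cell (φ : Cell2 P.toPol2 x y) (ψ : Cell2 P.toPol2 y z) : Cell3 P x z :=
  ⟨φ.leftFirst ψ, φ.rightFirst ψ, I.steps ψ.src ψ.tgt ψ.steps φ.steps,
    I.isChain_steps ψ φ.steps φ.src φ.tgt φ.valid⟩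

end Interchange

/-- The configurations of cells of a `3`-prepolygraph `P` with interchange generators `I` that
give rise to the structural `4`-generators of a Gray presentation:
* `indep`: `3`-generators `A : φ ⇛ φ'` and `B : ψ ⇛ ψ'`, `1`-cells `e`, `h`, `e'`, `h'` and a
  `2`-cell `χ : e ∘₀ t(φ) ∘₀ h ⇒ e' ∘₀ s(ψ) ∘₀ h'`;
* `nat₁`: `0`-composable `A`, `g`, `β` with `A` a `3`-generator, `g` a `1`-cell and `β` a
  `2`-generator;
* `nat₂`: `0`-composable `α`, `g`, `B` with `α` a `2`-generator, `g` a `1`-cell and `B` a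
  `3`-generator. -/
inductive Structural (P : Pol3) : P.P0 → P.P0 → Type
  | indep {w x y x' y' z : P.P0} (e : P.Cell1 w x) (A : P.P3 x y) (h : P.Cell1 y z)
      (χ : Cell2 P.toPol2 w z) (e' : P.Cell1 w x') (B : P.P3 x' y') (h' : P.Cell1 y' z)
      (src_χ : (e.comp (P.src3 A).tgt).comp h = χ.src)
      (tgt_χ : χ.tgt = (e'.comp (P.src3 B).src).comp h') : Structural P w z
  | nat₁ {x x' y' y : P.P0} (A : P.P3 x x') (g : P.Cell1 x' y') (β : P.P2 y' y) : Structural P x y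
  | nat₂ {x x' y' y : P.P0} (α : P.P2 x x') (g : P.Cell1 x' y') (B : P.P3 y' y) : Structural P x y

namespace Structural

variable {P : Pol3}

/-- `e ∘₀ A ∘₀ h` -/
def ctx {w x y z : P.P0} (e : P.Cell1 w x) (A : P.P3 x y) (h : P.Cell1 y z) : Cell3 P w z :=
  ((Cell3.gen A).lw e).rw h

/-- `(e ∘₀ A ∘₀ h) ∘₁ χ ∘₁ (e' ∘₀ θ ∘₀ h')`, where `θ` is `s(B)` or `t(B)`. -/
def upper {w x y x' y' z : P.P0} (e : P.Cell1 w x) (A : P.P3 x y) (h : P.Cell1 y z)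
    (χ : Cell2 P.toPol2 w z) (e' : P.Cell1 w x') (θ : Cell2 P.toPol2 x' y') (h' : P.Cell1 y' z)
    (src_χ : (e.comp (P.src3 A).tgt).comp h = χ.src)
    (tgt_χ : χ.tgt = (e'.comp θ.src).comp h') : Cell3 P w z :=
  (ctx e A h).rv (χ.comp ((θ.lw e').rw h') tgt_χ) src_χ

/-- `(e ∘₀ θ ∘₀ h) ∘₁ χ ∘₁ (e' ∘₀ B ∘₀ h')`, where `θ` is `s(A)` or `t(A)`. -/
def lower {w x y x' y' z : P.P0} (e : P.Cell1 w x) (θ : Cell2 P.toPol2 x y) (h : P.Cell1 y z)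
    (χ : Cell2 P.toPol2 w z) (e' : P.Cell1 w x') (B : P.P3 x' y') (h' : P.Cell1 y' z)
    (src_χ : (e.comp θ.tgt).comp h = χ.src)
    (tgt_χ : χ.tgt = (e'.comp (P.src3 B).src).comp h') : Cell3 P w z :=
  Cell3.lv (((θ.lw e).rw h).comp χ src_χ) (ctx e' B h') tgt_χ

/-- The source of a structural `4`-generator:
* `((e ∘₀ A ∘₀ h) ∘₁ χ ∘₁ (e' ∘₀ ψ ∘₀ h')) ∘₂ ((e ∘₀ φ' ∘₀ h) ∘₁ χ ∘₁ (e' ∘₀ B ∘₀ h'))` for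
  `indep`;
* `((A ∘₀ g ∘₀ h) ∘₁ (f' ∘₀ g ∘₀ β)) ∘₂ X_{φ', g ∘₀ β}` for `nat₁`, where
  `A : φ ⇛ φ' : f ⇒ f'` and `β : h ⇒ h'`;
* `((α ∘₀ g ∘₀ h) ∘₁ (f' ∘₀ g ∘₀ B)) ∘₂ X_{α ∘₀ g, ψ'}` for `nat₂`, where `α : f ⇒ f'` and
  `B : ψ ⇛ ψ' : h ⇒ h'`. -/
def src (I : Interchange P) {x y : P.P0} : Structural P x y → Cell3 P x y
  | indep e A h χ e' B h' p q =>
    (upper e A h χ e' (P.src3 B) h' p q).comp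
      (lower e (P.tgt3 A) h χ e' B h' (by rw [P.tgt_tgt3]; exact p) q)
      (by ext1 <;> simp [upper, lower, ctx, Cell3.lv, Cell3.rv, Cell3.lw, Cell3.rw, Cell3.gen,
            Chain.single, Chain.map, Chain.comp, Cell2.lw, Cell2.rw])
  | nat₁ A g β =>
    (((Cell3.gen A).rw (g.comp (P.src2 β))).rv
      (Cell2.lw (P.src3 A).tgt ((Cell2.gen β).lw g)) rfl).comp
      (I.cell (P.tgt3 A) ((Cell2.gen β).lw g))
      (by ext1 <;> simp [Interchange.cell, Cell2.leftFirst, Cell3.rv, Cell3.rw, Cell3.gen,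
            Chain.single, Chain.map, Chain.comp, Cell2.lw, Cell2.rw, Cell2.gen, P.tgt_tgt3])
  | nat₂ α g B =>
    (((Cell3.gen B).lw ((P.tgt2 α).comp g)).lv
      (((Cell2.gen α).rw g).rw (P.src3 B).src) rfl).comp
      (I.cell ((Cell2.gen α).rw g) (P.tgt3 B))
      (by ext1 <;> simp [Interchange.cell, Cell2.leftFirst, Cell3.lv, Cell3.lw, Cell3.gen,
            Chain.single, Chain.map, Chain.comp, Cell2.lw, Cell2.rw, Cell2.gen, P.src_tgt3])

/-- The target of a structural `4`-generator:
* `((e ∘₀ φ ∘₀ h) ∘₁ χ ∘₁ (e' ∘₀ B ∘₀ h')) ∘₂ ((e ∘₀ A ∘₀ h) ∘₁ χ ∘₁ (e' ∘₀ ψ' ∘₀ h'))` for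
  `indep`;
* `X_{φ, g ∘₀ β} ∘₂ ((f ∘₀ g ∘₀ β) ∘₁ (A ∘₀ g ∘₀ h'))` for `nat₁`;
* `X_{α ∘₀ g, ψ} ∘₂ ((f ∘₀ g ∘₀ B) ∘₁ (α ∘₀ g ∘₀ h'))` for `nat₂`. -/
def tgt (I : Interchange P) {x y : P.P0} : Structural P x y → Cell3 P x y
  | indep e A h χ e' B h' p q =>
    (lower e (P.src3 A) h χ e' B h' p q).comp
      (upper e A h χ e' (P.tgt3 B) h' p (by rw [P.src_tgt3]; exact q))
      (by ext1 <;> simp [upper, lower, ctx, Cell3.lv, Cell3.rv, Cell3.lw, Cell3.rw, Cell3.gen,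
            Chain.single, Chain.map, Chain.comp, Cell2.lw, Cell2.rw, P.tgt_tgt3])
  | nat₁ A g β =>
    (I.cell (P.src3 A) ((Cell2.gen β).lw g)).comp
      (((Cell3.gen A).rw (g.comp (P.tgt2 β))).lv
        (Cell2.lw (P.src3 A).src ((Cell2.gen β).lw g)) rfl)
      (by ext1 <;> simp [Interchange.cell, Cell2.rightFirst, Cell3.lv, Cell3.rw, Cell3.gen,
            Chain.single, Chain.map, Chain.comp, Cell2.lw, Cell2.rw, Cell2.gen])
  | nat₂ α g B =>
    (I.cell ((Cell2.gen α).rw g) (P.src3 B)).comp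
      (((Cell3.gen B).lw ((P.src2 α).comp g)).rv
        (((Cell2.gen α).rw g).rw (P.src3 B).tgt) rfl)
      (by ext1 <;> simp [Interchange.cell, Cell2.rightFirst, Cell3.rv, Cell3.lw, Cell3.gen,
            Chain.single, Chain.map, Chain.comp, Cell2.lw, Cell2.rw, Cell2.gen])

theorem src_tgt (I : Interchange P) {x y : P.P0} (S : Structural P x y) :
    (S.tgt I).src = (S.src I).src := by
  cases S <;> ext1 <;> simp [src, tgt, upper, lower, ctx, Interchange.cell, Cell2.leftFirst,
    Cell3.lv, Cell3.rv, Cell3.lw, Cell3.rw, Cell3.gen, Chain.single, Chain.map, Chain.comp,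
    Cell2.lw, Cell2.rw, Cell2.gen]

theorem tgt_tgt (I : Interchange P) {x y : P.P0} (S : Structural P x y) :
    (S.tgt I).tgt = (S.src I).tgt := by
  cases S <;> ext1 <;> simp [src, tgt, upper, lower, ctx, Interchange.cell, Cell2.rightFirst,
    Cell3.lv, Cell3.rv, Cell3.lw, Cell3.rw, Cell3.gen, Chain.single, Chain.map, Chain.comp,
    Cell2.lw, Cell2.rw, Cell2.gen, P.src_tgt3, P.tgt_tgt3]

end Structural

/-- A Gray presentation: a `4`-prepolygraph with distinguished interchange generators in dimension
`3`, and distinguished independence generators and interchange naturality generators in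
dimension `4`. -/
structure GrayPresentation extends Pol4 where
  I : Interchange toPol3
  structural {x y : P0} : Structural toPol3 x y → P4 x y
  src4_structural {x y : P0} (S : Structural toPol3 x y) : src4 (structural S) = S.src I
  tgt4_structural {x y : P0} (S : Structural toPol3 x y) : tgt4 (structural S) = S.tgt I

/-- A Gray presentation is coherent when the localization at all `3`-cells of the
`3`-precategory that it presents is coherent. -/
def GrayPresentation.Coherent (P : GrayPresentation) : Prop :=
  P.presented.localization.Coherent

/-! ### Pseudomonoids -/

namespace PseudoMonoid

/-- One `0`-generator `x` and one `1`-generator `a : x → x`. -/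
def pol1 : Pol1 where
  P0 := Unit
  P1 _ _ := Unit

/-- The `1`-cell `n̄ = a ∘₀ ⋯ ∘₀ a` (`n` times). -/
def bar : ℕ → pol1.Cell1 () ()
  | 0 => .nil
  | n + 1 => (bar n).cons ()

/-- The `2`-generators `μ : 2̄ ⇒ 1̄` and `η : 0̄ ⇒ 1̄`. -/
inductive Gen2
  | mu
  | eta

def pol2 : Pol2 where
  toPol1 := pol1
  P2 _ _ := Gen2
  src2
    | .mu => bar 2
    | .eta => bar 0
  tgt2 _ := bar 1

/-- The whisker `m̄ ∘₀ α ∘₀ n̄` -/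
def whisk (m : ℕ) (α : Gen2) (n : ℕ) : Cell2 pol2 () () :=
  Cell2.ofWhisker (P := pol2) (x := ()) (y := ()) ⟨bar m, α, bar n⟩

/-- The `3`-generators: `A : (μ ∘₀ 1̄) ∘₁ μ ⇛ (1̄ ∘₀ μ) ∘₁ μ`, `L : (η ∘₀ 1̄) ∘₁ μ ⇛ id(1̄)`,
`R : (1̄ ∘₀ η) ∘₁ μ ⇛ id(1̄)` and the interchange generators `X_{α,g,β}`. -/
inductive Gen3
  | A
  | L
  | R
  | X (α : Gen2) (g : pol1.Cell1 () ()) (β : Gen2)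

open Gen2

/-- The interchange generators have source `(α ∘₀ g ∘₀ h) ∘₁ (f' ∘₀ g ∘₀ β)` and target
`(f ∘₀ g ∘₀ β) ∘₁ (α ∘₀ g ∘₀ h')`, for `α : f ⇒ f'` and `β : h ⇒ h'`. -/
def pol3 : Pol3 where
  toPol2 := pol2
  P3 _ _ := Gen3
  src3
    | .A => (whisk 0 mu 1).comp (whisk 0 mu 0) rfl
    | .L => (whisk 0 eta 1).comp (whisk 0 mu 0) rfl
    | .R => (whisk 1 eta 0).comp (whisk 0 mu 0) rfl
    | .X α g β =>
      Cell2.leftFirst (P := pol2) (y := ()) (Cell2.gen (P := pol2) α)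
        ((Cell2.gen (P := pol2) (x := ()) β).lw g)
  tgt3
    | .A => (whisk 1 mu 0).comp (whisk 0 mu 0) rfl
    | .L => Chain.id (bar 1)
    | .R => Chain.id (bar 1)
    | .X α g β =>
      Cell2.rightFirst (P := pol2) (y := ()) (Cell2.gen (P := pol2) α)
        ((Cell2.gen (P := pol2) (x := ()) β).lw g)
  src_tgt3 G := by cases G <;> rfl
  tgt_tgt3 G := by cases G <;> rfl

/-- The interchange generators of `pol3`. -/
def interchange : Interchange pol3 where
  X α g β := Gen3.X α g β
  src_X _ _ _ := rfl
  tgt_X _ _ _ := rfl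

/-- The `3`-cell `m̄ ∘₀ G ∘₀ n̄` -/
def whisk3 (m : ℕ) (G : Gen3) (n : ℕ) : Cell3 pol3 () () :=
  ((Cell3.gen (P := pol3) (x := ()) (y := ()) G).lw (bar m)).rw (bar n)

/-- The interchange generator `X_{α,0̄,β}` -/
def X₀ (α β : Gen2) : Gen3 := .X α (bar 0) β

/-- The five additional `4`-generators. -/
inductive Gen4
  | R₁
  | R₂
  | R₃
  | R₄
  | R₅

/-- The sources of the additional `4`-generators:
* `R₁`: `((A ∘₀ 1̄) ∘₁ μ) ∘₂ ((1̄ ∘₀ μ ∘₀ 1̄) ∘₁ A) ∘₂ ((1̄ ∘₀ A) ∘₁ μ)`;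
* `R₂`: `((η ∘₀ 2̄) ∘₁ A) ∘₂ (X_{η,0̄,μ} ∘₁ μ) ∘₂ (μ ∘₁ L)`;
* `R₃`: `(X_{μ,0̄,η} ∘₁ μ) ∘₂ ((2̄ ∘₀ η) ∘₁ A) ∘₂ ((1̄ ∘₀ R) ∘₁ μ)`;
* `R₄`: `((1̄ ∘₀ η ∘₀ 1̄) ∘₁ A) ∘₂ ((1̄ ∘₀ L) ∘₁ μ)`;
* `R₅`: `(X_{η,0̄,η} ∘₁ μ) ∘₂ (η ∘₁ L)`. -/
def src4 : Gen4 → Cell3 pol3 () ()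
  | .R₁ =>
    ((whisk3 0 .A 1).rv (whisk 0 mu 0) rfl).comp
      ((Cell3.lv (whisk 1 mu 1) (whisk3 0 .A 0) rfl).comp
        ((whisk3 1 .A 0).rv (whisk 0 mu 0) rfl) rfl) rfl
  | .R₂ =>
    (Cell3.lv (whisk 0 eta 2) (whisk3 0 .A 0) rfl).comp
      (((whisk3 0 (X₀ eta mu) 0).rv (whisk 0 mu 0) rfl).comp
        (Cell3.lv (whisk 0 mu 0) (whisk3 0 .L 0) rfl) rfl) rfl
  | .R₃ =>
    ((whisk3 0 (X₀ mu eta) 0).rv (whisk 0 mu 0) rfl).comp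
      ((Cell3.lv (whisk 2 eta 0) (whisk3 0 .A 0) rfl).comp
        ((whisk3 1 .R 0).rv (whisk 0 mu 0) rfl) rfl) rfl
  | .R₄ =>
    (Cell3.lv (whisk 1 eta 1) (whisk3 0 .A 0) rfl).comp
      ((whisk3 1 .L 0).rv (whisk 0 mu 0) rfl) rfl
  | .R₅ =>
    ((whisk3 0 (X₀ eta eta) 0).rv (whisk 0 mu 0) rfl).comp
      (Cell3.lv (whisk 0 eta 0) (whisk3 0 .L 0) rfl) rfl

/-- The targets of the additional `4`-generators:
* `R₁`: `((μ ∘₀ 2̄) ∘₁ A) ∘₂ (X_{μ,0̄,μ} ∘₁ μ) ∘₂ ((2̄ ∘₀ μ) ∘₁ A)`;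
* `R₂`: `(L ∘₀ 1̄) ∘₁ μ`;
* `R₃`: `μ ∘₁ R`;
* `R₄`: `(R ∘₀ 1̄) ∘₁ μ`;
* `R₅`: `η ∘₁ R`. -/
def tgt4 : Gen4 → Cell3 pol3 () ()
  | .R₁ =>
    (Cell3.lv (whisk 0 mu 2) (whisk3 0 .A 0) rfl).comp
      (((whisk3 0 (X₀ mu mu) 0).rv (whisk 0 mu 0) rfl).comp
        (Cell3.lv (whisk 2 mu 0) (whisk3 0 .A 0) rfl) rfl) rfl
  | .R₂ => (whisk3 0 .L 1).rv (whisk 0 mu 0) rfl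
  | .R₃ => Cell3.lv (whisk 0 mu 0) (whisk3 0 .R 0) rfl
  | .R₄ => (whisk3 0 .R 1).rv (whisk 0 mu 0) rfl
  | .R₅ => Cell3.lv (whisk 0 eta 0) (whisk3 0 .R 0) rfl

end PseudoMonoid

open PseudoMonoid in
/-- The Gray presentation `PMon` of pseudomonoids: its `4`-generators are one independence or
interchange naturality generator for each configuration, and `R₁`, …, `R₅`. -/
def PMon : GrayPresentation where
  toPol3 := pol3
  P4 x y := Structural pol3 x y ⊕ Gen4
  src4
    | .inl S => S.src interchange
    | .inr G => src4 G
  tgt4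
    | .inl S => S.tgt interchange
    | .inr G => tgt4 G
  src_tgt4
    | .inl S => S.src_tgt interchange
    | .inr G => by cases G <;> rfl
  tgt_tgt4
    | .inl S => S.tgt_tgt interchange
    | .inr G => by cases G <;> rfl
  I := interchange
  structural := Sum.inl
  src4_structural _ := rfl
  tgt4_structural _ := rfl

end GrayCoherence

/-! The proof is Squier's argument, with 3-cells read as rewriting paths between 2-cells. Suppose
that rewriting terminates and that any two steps out of the same 2-cell can be prolonged to
congruent 3-cells. Newman's induction then shows that any two 3-cells from φ to normal forms are
congruent (`Pol4.equiv_of_normal`). Choose a 3-cell N φ from each φ to a normal form: for every F :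
φ ⇛ ψ the cells F ∘₂ N ψ and N φ are equal in the presented precategory. After localization F
therefore equals N φ followed by the inverse of N ψ, and so does every zigzag from φ to ψ, so that
only the endpoints matter (`Precat3.localization_coherent`).

For `PMon` it remains to check the two hypotheses.

Branchings (`joinable`). The source of every 3-generator consists of exactly two whiskers. Two steps
out of the same list of whiskers thus start at distance 0, 1, or at least 2. At distance 0 they
coincide, because a source in context determines its generator (`ctxSteps_inj`). At distance at
least 2 they rewrite disjoint parts, and an independence generator applies (`Pol4.Joinable.indep`).
At distance 1 they share one whisker (`joinable_overlap`). If an interchange slides a 2-generator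
past the whole source of the other step, this is a naturality generator. The remaining overlaps are
A/A, L/A, R/A, and X/R where the left 2-generator of X feeds the left input of R; they are filled by
R₁, R₂, R₄, and by R₃ and R₅.

Termination (`measure_lt`). L and R shorten the list of whiskers. A preserves the length and lowers
the sum of the sizes of left subtrees over all occurrences of μ. An interchange preserves both and
lowers a weighted sum of positions. -/

namespace GrayCoherence

/-! ### Coherence of a localization from a coherent choice of normalizing 3-cells -/

namespace Precat3

/-- Two zigzags with the same endpoints whose lists are related by an elementary
simplification are congruent. -/
theorem zigzag_congr {C : Precat3} {x y : C.C0} {F G : C.Zigzag x y} (hs : F.src = G.src)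
    (ht : F.tgt = G.tgt) (h : ZigzagRule C x y F.steps G.steps) :
    Congr C.zigzag C.zigzagRel.rel F G :=
  .of ⟨hs, ht, h⟩

/-- If every `2`-cell `φ` is the source of a `3`-cell `N φ` such that `F ∘₂ N (t F) = N (s F)` for
all `3`-cells `F`, then the localization is coherent. -/
theorem localization_coherent (C : Precat3) (N : ∀ {x y : C.C0}, C.C2 x y → C.C3 x y)
    (hN : ∀ {x y : C.C0} (φ : C.C2 x y), C.s2 (N φ) = φ)
    (hF : ∀ {x y : C.C0} (F : C.C3 x y), C.comp2 F (N (C.t2 F)) (hN _).symm = N (C.s2 F)) :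
    C.localization.Coherent := by
  have ht : ∀ {x y : C.C0} (F : C.C3 x y), C.t2 (N (C.t2 F)) = C.t2 (N (C.s2 F)) := by
    intro x y F
    rw [← hF F, C.t2_comp2]
  -- Any zigzag from φ to ψ followed by N ψ is congruent to N φ. The proofs that the lists are
  -- composable are part of the statement, since a chain carries such a proof.
  have key : ∀ {x y : C.C0} (es : List (C.C3 x y × Bool)) (φ ψ : C.C2 x y)
      (h : IsChain SignedStep φ es ψ),
      ∃ (h₁ : IsChain SignedStep φ (es ++ [(N ψ, true)]) (C.t2 (N φ)))
        (h₂ : IsChain SignedStep φ [(N φ, true)] (C.t2 (N φ))),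
        Congr C.zigzag C.zigzagRel.rel (x := x) (y := y) (⟨_, _, _, h₁⟩ : C.Zigzag x y)
          (⟨_, _, _, h₂⟩ : C.Zigzag x y) := by
    intro x y es
    induction es with
    | nil =>
      rintro φ ψ rfl
      have h : IsChain SignedStep φ [(N φ, true)] (C.t2 (N φ)) := ⟨_, ⟨(hN φ).symm, rfl⟩, rfl⟩
      exact ⟨h, h, .refl _⟩
    | cons e es ih =>
      rintro φ ψ ⟨c, he, h⟩
      obtain ⟨h₁, h₂, hc⟩ := ih c ψ h
      have h₃ : IsChain SignedStep φ [(N φ, true)] (C.t2 (N φ)) := ⟨_, ⟨(hN φ).symm, rfl⟩, rfl⟩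
      have e₁ : C.t2 (N c) = C.t2 (N φ) := by
        obtain ⟨F, _ | _⟩ := e <;> obtain ⟨rfl, rfl⟩ := he
        · exact (ht F).symm
        · exact ht F
      rw [e₁] at h₁ h₂
      simp only [e₁] at hc
      refine ⟨⟨c, he, h₁⟩, h₃, ?_⟩
      have h₄ : IsChain SignedStep φ [e] c := ⟨c, he, rfl⟩
      have h₅ := Congr.comp2 (C := C.zigzag) (F := (⟨_, _, _, h₄⟩ : C.Zigzag x y)) rfl rfl
        (.refl _) hc
      refine h₅.trans ?_
      obtain ⟨F, _ | _⟩ := e <;> obtain ⟨rfl, rfl⟩ := he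
      -- For a backward cell F⁻ the rule `pos` is used from right to left: N (s F) splits as F
      -- followed by N (t F), and then F⁻ F⁺ cancels.
      · have h₆ : IsChain SignedStep (C.t2 F) [(F, false), (F, true), (N (C.t2 F), true)]
            (C.t2 (N (C.t2 F))) :=
          ⟨_, ⟨rfl, rfl⟩, _, ⟨rfl, rfl⟩, _, ⟨(hN _).symm, rfl⟩, rfl⟩
        refine Congr.trans (C := C.zigzag) (G := (⟨_, _, _, h₆⟩ : C.Zigzag x y))
          (Congr.symm (zigzag_congr rfl rfl ?_)) (zigzag_congr rfl rfl (.cancel [] _ F false))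
        have := ZigzagRule.pos (C := C) [(F, false)] [] F (N (C.t2 F)) (hN _).symm
        rwa [hF] at this
      · refine zigzag_congr rfl rfl ?_
        have := ZigzagRule.pos (C := C) [] [] F (N (C.t2 F)) (hN _).symm
        rwa [hF] at this
  -- A zigzag is congruent to N⁺ of its source followed by N⁻ of its target, a zigzag that depends
  -- on the endpoints only.
  have key' : ∀ {x y : C.C0} (F : C.Zigzag x y),
      ∃ h : IsChain SignedStep F.src [(N F.src, true), (N F.tgt, false)] F.tgt,
        Congr C.zigzag C.zigzagRel.rel F (⟨_, _, _, h⟩ : C.Zigzag x y) := by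
    rintro x y ⟨φ, ψ, es, h⟩
    obtain ⟨h₁, h₂, hc⟩ := key es φ ψ h
    have e₁ : C.t2 (N ψ) = C.t2 (N φ) := by
      clear h₁ h₂ hc
      induction es generalizing φ with
      | nil => cases h; rfl
      | cons e es ih =>
        obtain ⟨c, he, h⟩ := h
        rw [ih _ h]
        obtain ⟨F, _ | _⟩ := e <;> obtain ⟨rfl, rfl⟩ := he
        · exact (ht F).symm
        · exact ht F
    have h₃ : IsChain SignedStep (C.t2 (N φ)) [(N ψ, false)] ψ :=
      ⟨ψ, ⟨e₁.symm, (hN ψ).symm⟩, rfl⟩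
    refine ⟨h₂.append h₃, ?_⟩
    have h₅ := Congr.comp2 (C := C.zigzag) (G := (⟨_, _, _, h₃⟩ : C.Zigzag x y)) rfl rfl hc
      (.refl _)
    -- Appending N ψ⁺ N ψ⁻ does not change the class of the zigzag; `key` then absorbs the zigzag
    -- and N ψ⁺ into N φ⁺.
    have h₆ := ZigzagRule.cancel es [] (N ψ) true
    rw [List.append_nil] at h₆
    have h₇ : Congr C.zigzag C.zigzagRel.rel (C.zigzag.comp2 (x := x) (y := y)
        (⟨_, _, _, h₁⟩ : C.Zigzag x y) (⟨_, _, _, h₃⟩ : C.Zigzag x y) rfl)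
        (⟨_, _, _, h⟩ : C.Zigzag x y) := by
      refine zigzag_congr rfl rfl ?_
      change ZigzagRule C x y ((es ++ [(N ψ, true)]) ++ [(N ψ, false)]) es
      rwa [List.append_assoc]
    exact h₇.symm.trans h₅
  intro x y
  refine QCell.ind fun F => QCell.ind fun G => fun hs ht => ?_
  obtain ⟨h, hc⟩ := key' F
  obtain ⟨h', hc'⟩ := key' G
  refine QCell.sound (hc.trans ?_)
  obtain ⟨φ, ψ, es, hes⟩ := F
  obtain ⟨φ', ψ', es', hes'⟩ := G
  change φ = φ' at hs
  change ψ = ψ' at ht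
  subst hs ht
  exact hc'.symm

end Precat3

/-! ### Convergence up to congruence -/

namespace Pol4

variable {P : Pol4} {x y z : P.P0}

/-- The congruence on `3`-cells generated by the `4`-generators. -/
abbrev Equiv (P : Pol4) {x y : P.P0} (F G : Cell3 P.toPol3 x y) : Prop :=
  Precat3.Congr P.toPol3.free P.rel.rel (x := x) (y := y) F G

theorem Equiv.src_eq {F G : Cell3 P.toPol3 x y} (h : P.Equiv F G) : F.src = G.src :=
  (Precat3.Congr.parallel h).1

theorem Equiv.tgt_eq {F G : Cell3 P.toPol3 x y} (h : P.Equiv F G) : F.tgt = G.tgt :=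
  (Precat3.Congr.parallel h).2

/-- `3`-cells `F₁` and `F₂` of source `φ` that start with the steps `W₁` and `W₂` are congruent. -/
def Joinable (P : Pol4) {x y : P.P0} (φ : Cell2 P.toPol2 x y) (W₁ W₂ : Whisker3 P.toPol3 x y) :
    Prop :=
  ∃ F₁ F₂ : Cell3 P.toPol3 x y, F₁.src = φ ∧ P.Equiv F₁ F₂ ∧ F₁.steps.head? = some W₁ ∧
    F₂.steps.head? = some W₂

/-- `φ` rewrites to `ψ` in one step. -/
def Red (P : Pol4) {x y : P.P0} (ψ φ : Cell2 P.toPol2 x y) : Prop :=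
  ∃ W : Whisker3 P.toPol3 x y, W.Step φ ψ

end Pol4

/-- A step leaves the bounding 1-cells of a 2-cell unchanged, and the whiskers of its target are
read off from `W`. The 1-cells must be compared separately because `W` does not record them. -/
theorem Whisker3.Step.right_unique {P : Pol3} {x y : P.P0} {W : Whisker3 P x y}
    {φ ψ ψ' : Cell2 P.toPol2 x y} (h : W.Step φ ψ) (h' : W.Step φ ψ') : ψ = ψ' := by
  have hs := h.src_eq.trans h'.src_eq.symm
  have ht := h.tgt_eq.trans h'.tgt_eq.symm
  obtain ⟨lam, rho, _, _, _, _, e₁, e₂, -, e₃⟩ := h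
  obtain ⟨lam', rho', _, _, _, _, e₁', e₂', -, e₃'⟩ := h'
  ext1
  · exact hs
  · exact ht
  · rw [e₃, e₃']; simp [Chain.comp, e₁, e₂, e₁', e₂']

namespace Pol4

variable {P : Pol4} {x y z : P.P0}

theorem exists_normal (wf : WellFounded (P.Red (x := x) (y := y))) (φ : Cell2 P.toPol2 x y) :
    ∃ F : Cell3 P.toPol3 x y, F.src = φ ∧ ∀ ψ, ¬ P.Red ψ F.tgt := by
  induction φ using wf.induction with
  | _ φ ih =>
    by_cases h : ∃ ψ, P.Red ψ φ
    · obtain ⟨ψ, W, hW⟩ := h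
      obtain ⟨F, rfl, hF⟩ := ih ψ ⟨W, hW⟩
      exact ⟨(Chain.single W _ _ hW).comp F rfl, rfl, hF⟩
    · exact ⟨Chain.id φ, rfl, fun ψ hψ => h ⟨ψ, hψ⟩⟩

/-- Newman's lemma one dimension up: joining a branching means filling it by a congruence. Equality
of the two normal forms is not assumed; it is a consequence, since congruent 3-cells are parallel.
-/
theorem equiv_of_normal (wf : WellFounded (P.Red (x := x) (y := y)))
    (hj : ∀ (φ ψ₁ ψ₂ : Cell2 P.toPol2 x y) W₁ W₂, Whisker3.Step W₁ φ ψ₁ → Whisker3.Step W₂ φ ψ₂ →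
      P.Joinable φ W₁ W₂) (φ : Cell2 P.toPol2 x y) :
    ∀ F G : Cell3 P.toPol3 x y, F.src = φ → G.src = φ → (∀ ψ, ¬ P.Red ψ F.tgt) →
      (∀ ψ, ¬ P.Red ψ G.tgt) → P.Equiv F G := by
  induction φ using wf.induction with
  | _ φ ih =>
    rintro ⟨_, a, es, h⟩ ⟨_, b, es', h'⟩ rfl e hF hG
    change _ = _ at e
    subst e
    -- If one of the two paths is empty, then φ is a normal form and the other path must be empty as
    -- well.
    rcases es with _ | ⟨W, es⟩
    · change _ = _ at h
      subst h
      rcases es' with _ | ⟨W', es'⟩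
      · change _ = _ at h'
        subst h'
        exact .refl _
      · obtain ⟨c, hc, _⟩ := h'
        exact absurd ⟨W', hc⟩ (hF c)
    rcases es' with _ | ⟨W', es'⟩
    · change _ = _ at h'
      subst h'
      obtain ⟨c, hc, _⟩ := h
      exact absurd ⟨W, hc⟩ (hG c)
    obtain ⟨c, hc, h⟩ := h
    obtain ⟨c', hc', h'⟩ := h'
    obtain ⟨⟨f₁, g₁, l₁, k₁⟩, ⟨f₂, g₂, l₂, k₂⟩, e₁, hE, hW₁, hW₂⟩ := hj _ _ _ W W' hc hc'
    have e₂ := hE.src_eq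
    have e₃ := hE.tgt_eq
    dsimp only at e₁ e₂ e₃ hW₁ hW₂
    subst e₁ e₂ e₃
    rcases l₁ with _ | ⟨_, l₁⟩
    · simp at hW₁
    rcases l₂ with _ | ⟨_, l₂⟩
    · simp at hW₂
    simp only [List.head?_cons, Option.some.injEq] at hW₁ hW₂
    subst hW₁ hW₂
    obtain ⟨d, hd, k₁'⟩ := k₁
    obtain ⟨d', hd', k₂'⟩ := k₂
    obtain rfl := hc.right_unique hd
    obtain rfl := hc'.right_unique hd'
    -- The congruent paths that begin with `W` and `W'` end at the same 2-cell `g₁`. Prolonging both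
    -- by one path to a normal form makes the induction hypothesis applicable after the step `W` and
    -- after the step `W'`; the three congruences are then pasted.
    obtain ⟨⟨_, n, ns, hn⟩, rfl, hN⟩ := exists_normal wf g₁
    have E₁ := ih c ⟨_, hc⟩ ⟨c, a, es, h⟩ ⟨c, n, l₁ ++ ns, k₁'.append hn⟩ rfl rfl hF hN
    have E₂ := ih c' ⟨_, hc'⟩ ⟨c', b, es', h'⟩ ⟨c', n, l₂ ++ ns, k₂'.append hn⟩ rfl rfl hG hN
    have E₃ := Precat3.Congr.comp2 (C := P.toPol3.free) (F := Chain.single _ _ _ hc) rfl rfl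
      (.refl _) E₁
    have E₄ := Precat3.Congr.comp2 (C := P.toPol3.free) (F := Chain.single _ _ _ hc') rfl rfl
      (.refl _) E₂
    have E₅ := Precat3.Congr.comp2 (C := P.toPol3.free) rfl rfl hE
      (.refl (⟨_, n, ns, hn⟩ : Cell3 P.toPol3 x y))
    exact E₃.trans (E₅.trans E₄.symm)

/-- A terminating prepolygraph all of whose branchings are joinable up to congruence presents a
`3`-precategory with coherent localization. -/
theorem localization_coherent (P : Pol4)
    (wf : ∀ x y : P.P0, WellFounded (P.Red (x := x) (y := y)))
    (hj : ∀ (x y : P.P0) (φ ψ₁ ψ₂ : Cell2 P.toPol2 x y) W₁ W₂, Whisker3.Step W₁ φ ψ₁ →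
      Whisker3.Step W₂ φ ψ₂ → P.Joinable φ W₁ W₂) :
    P.presented.localization.Coherent := by
  choose N hN hN' using fun x y => exists_normal (wf x y)
  refine Precat3.localization_coherent P.presented
    (fun {x y} φ => Precat3.QCell.cls P.rel (N x y φ)) (fun {x y} φ => hN x y φ) ?_
  intro x y F
  induction F using Precat3.QCell.ind with
  | _ F =>
    refine (Precat3.QCell.comp2_cls F (N x y (Chain.tgt F)) (hN x y _).symm).trans
      (Precat3.QCell.sound (C := P.toPol3.free) (R := P.rel) (x := x) (y := y)
        (G := N x y (Chain.src F)) ?_)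
    -- Both F followed by the chosen path and the path chosen for the source of F lead from that
    -- source to normal forms.
    exact equiv_of_normal (wf x y) (hj x y) (Chain.src F) _ _ rfl (hN x y _)
      (hN' x y _) (hN' x y _)

/-! ### Joinable branchings -/

namespace Joinable

variable {φ : Cell2 P.toPol2 x y} {W₁ W₂ : Whisker3 P.toPol3 x y}

theorem symm (h : P.Joinable φ W₁ W₂) : P.Joinable φ W₂ W₁ := by
  obtain ⟨F₁, F₂, rfl, hE, h₁, h₂⟩ := h
  exact ⟨F₂, F₁, hE.src_eq.symm, hE.symm, h₂, h₁⟩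

theorem of_gen (G : P.P4 x y) (hφ : (P.src4 G).src = φ)
    (h₁ : (P.src4 G).steps.head? = some W₁) (h₂ : (P.tgt4 G).steps.head? = some W₂) :
    P.Joinable φ W₁ W₂ :=
  ⟨_, _, hφ, .of ⟨G, rfl, rfl⟩, h₁, h₂⟩

theorem of_step {ψ : Cell2 P.toPol2 x y} (h : W₁.Step φ ψ) : P.Joinable φ W₁ W₁ :=
  ⟨Chain.single W₁ _ _ h, _, rfl, .refl _, rfl, rfl⟩

theorem lw (f : P.Cell1 z x) (h : P.Joinable φ W₁ W₂) :
    P.Joinable (Cell2.lw f φ) (W₁.lw f) (W₂.lw f) := by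
  obtain ⟨F₁, F₂, rfl, hE, h₁, h₂⟩ := h
  refine ⟨_, _, rfl, Precat3.Congr.lw3 (C := P.toPol3.free) f hE, ?_, ?_⟩ <;>
    simp [Pol3.free, Cell3.lw, Chain.map, h₁, h₂]

theorem rw (f : P.Cell1 y z) (h : P.Joinable φ W₁ W₂) :
    P.Joinable (Cell2.rw φ f) (W₁.rw f) (W₂.rw f) := by
  obtain ⟨F₁, F₂, rfl, hE, h₁, h₂⟩ := h
  refine ⟨_, _, rfl, Precat3.Congr.rw3 (C := P.toPol3.free) f hE, ?_, ?_⟩ <;>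
    simp [Pol3.free, Cell3.rw, Chain.map, h₁, h₂]

theorem lv (χ : Cell2 P.toPol2 x y) (hχ : χ.tgt = φ.src) (h : P.Joinable φ W₁ W₂) :
    P.Joinable (χ.comp φ hχ) (W₁.lv χ.steps) (W₂.lv χ.steps) := by
  obtain ⟨F₁, F₂, rfl, hE, h₁, h₂⟩ := h
  refine ⟨_, _, rfl, Precat3.Congr.lv3 (C := P.toPol3.free) χ hχ
    (hχ.trans (congrArg Chain.src hE.src_eq)) hE, ?_, ?_⟩ <;>
    simp [Pol3.free, Cell3.lv, h₁, h₂]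

theorem rv (χ : Cell2 P.toPol2 x y) (hχ : φ.tgt = χ.src) (h : P.Joinable φ W₁ W₂) :
    P.Joinable (φ.comp χ hχ) (W₁.rv χ.steps) (W₂.rv χ.steps) := by
  obtain ⟨F₁, F₂, rfl, hE, h₁, h₂⟩ := h
  refine ⟨_, _, rfl, Precat3.Congr.rv3 (C := P.toPol3.free) χ hχ
    ((congrArg Chain.tgt hE.src_eq).symm.trans hχ) hE, ?_, ?_⟩ <;>
    simp [Pol3.free, Cell3.rv, h₁, h₂]

end Joinable

end Pol4

end GrayCoherence

/-! ### Branchings inside a larger 2-cell, and independent steps -/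

namespace GrayCoherence

theorem IsChain.of_append {O E : Type} {step : E → O → O → Prop} {a b : O} {es es' : List E}
    (h : IsChain step a (es ++ es') b) : ∃ c, IsChain step a es c ∧ IsChain step c es' b := by
  induction es generalizing a with
  | nil => exact ⟨a, rfl, h⟩
  | cons e es ih =>
    obtain ⟨d, hd, h⟩ := h
    obtain ⟨c, hc, h⟩ := ih h
    exact ⟨c, ⟨d, hd, hc⟩, h⟩

/-- The endpoints of a nonempty chain of whiskers are determined by the whiskers. -/
theorem Whisker2.isChain_unique {P : Pol2} {x y : P.P0} {es : List (Whisker2 P x y)}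
    {a a' b b' : P.Cell1 x y} (hn : es ≠ []) (h : IsChain Step a es b)
    (h' : IsChain Step a' es b') : a = a' ∧ b = b' := by
  induction es generalizing a a' with
  | nil => exact absurd rfl hn
  | cons e es ih =>
    obtain ⟨d, ⟨rfl, rfl⟩, h⟩ := h
    obtain ⟨d, ⟨rfl, rfl⟩, h'⟩ := h'
    refine ⟨rfl, ?_⟩
    rcases es with _ | ⟨e', es⟩
    · exact h.symm.trans h'
    · exact (ih (by simp) h h').2

/-- A whisker determines its own boundary, so one whisker is enough to fix both ends of the chain.
The identities must be excluded: the empty list fits every 1-cell. -/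
theorem Cell2.ext_steps {P : Pol2} {x y : P.P0} {φ ψ : Cell2 P x y} (h : φ.steps = ψ.steps)
    (hn : φ.steps ≠ []) : φ = ψ := by
  obtain ⟨a, b, es, hes⟩ := φ
  obtain ⟨a', b', es', hes'⟩ := ψ
  dsimp only at h
  subst h
  obtain ⟨rfl, rfl⟩ := Whisker2.isChain_unique hn hes hes'
  rfl

theorem Whisker3.Step.steps_eq {P : Pol3} {x y : P.P0} {W : Whisker3 P x y}
    {φ ψ : Cell2 P.toPol2 x y} (h : W.Step φ ψ) :
    φ.steps = W.top ++ (W.midSrc.steps ++ W.bot) ∧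
      ψ.steps = W.top ++ (W.midTgt.steps ++ W.bot) := by
  obtain ⟨lam, rho, _, _, _, _, e₁, e₂, rfl, rfl⟩ := h
  simp [Chain.comp, e₁, e₂]

namespace Pol4.Joinable

/-- Joinability is preserved by composition with `2`-cells on both sides. -/
theorem context {P : Pol4} {x y : P.P0} {φ φ₀ : Cell2 P.toPol2 x y}
    {W₁ W₂ : Whisker3 P.toPol3 x y} (top bot : List (Whisker2 P.toPol2 x y))
    (hφ : φ.steps = top ++ (φ₀.steps ++ bot)) (hn : φ₀.steps ≠ []) (h : P.Joinable φ₀ W₁ W₂) :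
    P.Joinable φ ((W₁.rv bot).lv top) ((W₂.rv bot).lv top) := by
  have hv := φ.valid
  rw [hφ] at hv
  obtain ⟨c, h₁, hv⟩ := hv.of_append
  obtain ⟨d, h₂, h₃⟩ := hv.of_append
  -- The segment of φ with the whiskers of `φ₀` has the same endpoints as `φ₀`, which allows φ to be
  -- factored through `φ₀` itself.
  obtain ⟨rfl, rfl⟩ := Whisker2.isChain_unique hn h₂ φ₀.valid
  have e : φ = Chain.comp ⟨_, _, _, h₁⟩ (φ₀.comp ⟨_, _, _, h₃⟩ rfl) rfl := by
    ext1
    · rfl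
    · rfl
    · exact hφ
  rw [e]
  have h₄ := rv ⟨_, _, _, h₃⟩ rfl h
  exact lv (φ := φ₀.comp ⟨_, _, _, h₃⟩ rfl) ⟨_, _, _, h₁⟩ rfl h₄

/-- Steps that rewrite disjoint parts of a `2`-cell are joinable. -/
theorem indep {P : GrayPresentation} {x y : P.P0} {φ : Cell2 P.toPol2 x y}
    {x₁ y₁ x₂ y₂ : P.P0} (e : P.Cell1 x x₁) (A : P.P3 x₁ y₁) (h : P.Cell1 y₁ y)
    (ws : List (Whisker2 P.toPol2 x y)) (e' : P.Cell1 x x₂) (B : P.P3 x₂ y₂) (h' : P.Cell1 y₂ y)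
    (hA : (P.src3 A).steps ≠ []) (hB : (P.src3 B).steps ≠ [])
    (hφ : φ.steps = (((P.src3 A).lw e).rw h).steps ++ (ws ++ (((P.src3 B).lw e').rw h').steps)) :
    P.Joinable φ ⟨[], e, A, h, ws ++ (((P.src3 B).lw e').rw h').steps⟩
      ⟨(((P.src3 A).lw e).rw h).steps ++ ws, e', B, h', []⟩ := by
  have hv := φ.valid
  rw [hφ] at hv
  obtain ⟨c, h₁, hv⟩ := hv.of_append
  obtain ⟨d, h₂, h₃⟩ := hv.of_append
  have hA' : (((P.src3 A).lw e).rw h).steps ≠ [] := by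
    simpa [Cell2.lw, Cell2.rw, Chain.map] using hA
  have hB' : (((P.src3 B).lw e').rw h').steps ≠ [] := by
    simpa [Cell2.lw, Cell2.rw, Chain.map] using hB
  obtain ⟨i₁, rfl⟩ := Whisker2.isChain_unique hA' h₁ (((P.src3 A).lw e).rw h).valid
  obtain ⟨rfl, i₂⟩ := Whisker2.isChain_unique hB' h₃ (((P.src3 B).lw e').rw h').valid
  -- The 2-cell χ of the independence generator is the segment `ws` between the two redexes,
  -- possibly an identity. Its endpoints are forced by the nonempty sources of `A` and `B`.
  refine of_gen (P.structural (.indep e A h ⟨_, _, _, h₂⟩ e' B h' rfl rfl)) ?_ ?_ ?_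
  · rw [P.src4_structural]
    ext1
    · exact i₁.symm
    · exact i₂.symm
    · rw [hφ]
      rfl
  · rw [P.src4_structural]
    simp [Structural.src, Structural.upper, Structural.ctx, Cell3.rv, Cell3.rw, Cell3.lw,
      Cell3.gen, Chain.single, Chain.comp, Chain.map, Whisker3.lw, Whisker3.rw, Whisker3.rv]
  · rw [P.tgt4_structural]
    simp [Structural.tgt, Structural.lower, Structural.ctx, Cell3.lv, Cell3.rw, Cell3.lw,
      Cell3.gen, Chain.single, Chain.comp, Chain.map, Whisker3.lw, Whisker3.rw, Whisker3.lv]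

end Pol4.Joinable
end GrayCoherence

/-! ### Cells of `PMon` encoded by natural numbers -/

namespace GrayCoherence
namespace PseudoMonoid
open Gen2

/-- Concatenation of `1`-cells. -/
def cat (p q : pol1.Cell1 () ()) : pol1.Cell1 () () := Quiver.Path.comp (V := pol1.P0) p q

theorem cat_bar (m n : ℕ) : cat (bar m) (bar n) = bar (m + n) := by
  induction n with
  | zero => rfl
  | succ n ih =>
    exact congrArg (fun p : pol1.Cell1 () () =>
      Quiver.Path.cons (V := pol1.P0) (b := ()) (c := ()) p ()) ih

theorem exists_eq_bar (p : pol1.Cell1 () ()) : ∃ n, p = bar n := by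
  have h : ∀ {y : pol1.P0} (p : pol1.Cell1 () y), ∃ n, p = bar n := by
    intro y p
    induction p with
    | nil => exact ⟨0, rfl⟩
    | cons p e ih =>
      obtain ⟨n, rfl⟩ := ih
      exact ⟨n + 1, rfl⟩
  exact h p

theorem length_bar (n : ℕ) : (bar n).length = n := by
  induction n with
  | zero => rfl
  | succ n ih => exact congrArg (· + 1) ih

/-- The width of the source of a `2`-generator. -/
def Gen2.width : Gen2 → ℕ
  | mu => 2
  | eta => 0

theorem src2_eq (α : Gen2) : pol2.src2 (x := ()) (y := ()) α = bar α.width := by cases α <;> rfl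

/-- The whisker `l̄ ∘₀ α ∘₀ r̄` of dimension `2`. -/
def whisker2 (l : ℕ) (α : Gen2) (r : ℕ) : Whisker2 pol2 () () := ⟨bar l, α, bar r⟩

/-- The whisker of dimension `3` given by `l̄ ∘₀ G ∘₀ r̄` between two lists of whiskers. -/
def whisker3 (top : List (Whisker2 pol2 () ())) (l : ℕ) (G : Gen3) (r : ℕ)
    (bot : List (Whisker2 pol2 () ())) : Whisker3 pol3 () () :=
  ⟨top, bar l, G, bar r, bot⟩

/-- The numbers are recovered as lengths of paths. This turns every overlap of sources into linear
equations between positions. -/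
theorem whisker2_inj {l α r l' α' r'} :
    whisker2 l α r = whisker2 l' α' r' ↔ l = l' ∧ α = α' ∧ r = r' := by
  refine ⟨fun h => ?_, by rintro ⟨rfl, rfl, rfl⟩; rfl⟩
  have h₁ := congrArg (fun w : Whisker2 pol2 () () => (w.l.length, w.r.length)) h
  have h₂ := congrArg (fun w : Whisker2 pol2 () () => (w.α : Gen2)) h
  have h₃ := (length_bar l).symm.trans ((congrArg Prod.fst h₁).trans (length_bar l'))
  have h₄ := (length_bar r).symm.trans ((congrArg Prod.snd h₁).trans (length_bar r'))
  exact ⟨h₃, h₂, h₄⟩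

theorem exists_eq_whisker3 (W : Whisker3 pol3 () ()) :
    ∃ top l G r bot, W = whisker3 top l G r bot := by
  obtain ⟨top, l, G, r, bot⟩ := W
  obtain ⟨l, rfl⟩ := exists_eq_bar l
  obtain ⟨r, rfl⟩ := exists_eq_bar r
  exact ⟨top, l, G, r, bot, rfl⟩

theorem whisker2_mk {p q : pol1.Cell1 () ()} {l r : ℕ} (α : Gen2) (hp : p = bar l)
    (hq : q = bar r) : (⟨p, α, q⟩ : Whisker2 pol2 () ()) = whisker2 l α r := by
  subst hp hq; rfl

theorem whisker3_mk {p q : pol1.Cell1 () ()} {l r : ℕ} (top : List (Whisker2 pol2 () ()))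
    (G : Gen3) (bot) (hp : p = bar l) (hq : q = bar r) :
    (⟨top, p, G, q, bot⟩ : Whisker3 pol3 () ()) = whisker3 top l G r bot := by
  subst hp hq; rfl

theorem lw_whisker2 (m l : ℕ) (α : Gen2) (r : ℕ) :
    (whisker2 l α r).lw (bar m) = whisker2 (m + l) α r :=
  whisker2_mk α (cat_bar m l) rfl

theorem rw_whisker2 (m l : ℕ) (α : Gen2) (r : ℕ) :
    (whisker2 l α r).rw (bar m) = whisker2 l α (r + m) :=
  whisker2_mk α rfl (cat_bar r m)

theorem lw_whisker3 (m : ℕ) (top l G r bot) :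
    (whisker3 top l G r bot).lw (bar m) = whisker3 (top.map (Whisker2.lw (bar m))) (m + l) G r
      (bot.map (Whisker2.lw (bar m))) :=
  whisker3_mk _ G _ (cat_bar m l) rfl

theorem rw_whisker3 (m : ℕ) (top l G r bot) :
    (whisker3 top l G r bot).rw (bar m) = whisker3 (top.map (fun w => w.rw (bar m))) l G (r + m)
      (bot.map (fun w => w.rw (bar m))) :=
  whisker3_mk _ G _ rfl (cat_bar r m)

theorem exists_gen3 {p : Gen3 → Prop} (hA : p .A) (hL : p .L) (hR : p .R)
    (hX : ∀ α n β, p (.X α (bar n) β)) (G : Gen3) : p G := by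
  rcases G with _ | _ | _ | ⟨α, g, β⟩
  · exact hA
  · exact hL
  · exact hR
  · obtain ⟨n, rfl⟩ := exists_eq_bar g
    exact hX α n β

/-- The whiskers of the source of `G`. -/
def srcSteps (G : Gen3) : List (Whisker2 pol2 () ()) :=
  match G with
  | .A => [whisker2 0 mu 1, whisker2 0 mu 0]
  | .L => [whisker2 0 eta 1, whisker2 0 mu 0]
  | .R => [whisker2 1 eta 0, whisker2 0 mu 0]
  | .X α g β => [whisker2 0 α (g.length + β.width), whisker2 (1 + g.length) β 0]

/-- The whiskers of the target of `G`. -/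
def tgtSteps (G : Gen3) : List (Whisker2 pol2 () ()) :=
  match G with
  | .A => [whisker2 1 mu 0, whisker2 0 mu 0]
  | .L => []
  | .R => []
  | .X α g β => [whisker2 (α.width + g.length) β 0, whisker2 0 α (g.length + 1)]

theorem steps_src3 (G : Gen3) : (pol3.src3 (x := ()) (y := ()) G).steps = srcSteps G := by
  induction G using exists_gen3 with
  | hA | hL | hR => rfl
  | hX α n β =>
    have e₁ := rw_whisker2 (n + β.width) 0 α 0
    have e₂ := lw_whisker2 (1 + n) 0 β 0
    simp only [← cat_bar, ← src2_eq, Nat.zero_add, Nat.add_zero] at e₁ e₂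
    simp only [srcSteps, length_bar, ← e₁, ← e₂]
    rfl

theorem steps_tgt3 (G : Gen3) : (pol3.tgt3 (x := ()) (y := ()) G).steps = tgtSteps G := by
  induction G using exists_gen3 with
  | hA | hL | hR => rfl
  | hX α n β =>
    have e₁ := rw_whisker2 (n + 1) 0 α 0
    have e₂ := lw_whisker2 (α.width + n) 0 β 0
    simp only [Nat.zero_add, Nat.add_zero] at e₁ e₂
    simp only [← cat_bar, ← src2_eq] at e₂
    simp only [tgtSteps, length_bar, ← e₁, ← e₂]
    rfl

theorem midSrc_whisker3 (top l G r bot) :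
    (whisker3 top l G r bot).midSrc.steps =
      ((srcSteps G).map (Whisker2.lw (bar l))).map (fun w => w.rw (bar r)) := by
  rw [← steps_src3]
  rfl

theorem midTgt_whisker3 (top l G r bot) :
    (whisker3 top l G r bot).midTgt.steps =
      ((tgtSteps G).map (Whisker2.lw (bar l))).map (fun w => w.rw (bar r)) := by
  rw [← steps_tgt3]
  rfl

/-! ### First steps of the interchange naturality generators -/

/-- The naturality `4`-generator given by `G`, `n̄` and `β`. -/
def gen₁ (G : Gen3) (n : ℕ) (β : Gen2) : PMon.P4 () () :=
  Sum.inl (Structural.nat₁ (P := pol3) (x := ()) (x' := ()) (y' := ()) (y := ()) G (bar n) β)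

/-- The naturality `4`-generator given by `α`, `n̄` and `G`. -/
def gen₂ (α : Gen2) (n : ℕ) (G : Gen3) : PMon.P4 () () :=
  Sum.inl (Structural.nat₂ (P := pol3) (x := ()) (x' := ()) (y' := ()) (y := ()) α (bar n) G)

theorem head_src_nat₁ (G : Gen3) (t n : ℕ) (β : Gen2)
    (h : (pol3.src3 (x := ()) (y := ()) G).tgt = bar t) :
    (PMon.src4 (x := ()) (y := ()) (gen₁ G n β)).steps.head? =
      some (whisker3 [] 0 G (n + β.width) [whisker2 (t + n) β 0]) := by
  refine congrArg some ?_
  have e₁ : Whisker2.lw (cat (bar t) (bar n)) (whisker2 0 β 0) = whisker2 (t + n) β 0 := by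
    rw [cat_bar, lw_whisker2]; rfl
  rw [← e₁, ← h]
  refine whisker3_mk [] G _ rfl ?_
  change cat (bar 0) (cat (bar n) (pol2.src2 β)) = _
  rw [src2_eq, cat_bar, cat_bar, Nat.zero_add]

/-- The standard path defining X_{φ,ψ} begins with the last generator of φ. Here φ is the source of
`G`, so its second whisker is the first to be exchanged with β, while `u` stays above. -/
theorem head_tgt_nat₁ (G : Gen3) (n : ℕ) (β : Gen2) (u a α b)
    (h : srcSteps G = [u, whisker2 a α b]) :
    (PMon.tgt4 (x := ()) (y := ()) (gen₁ G n β)).steps.head? =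
      some (whisker3 [u.rw (bar (n + β.width))] a (.X α (bar (b + n)) β) 0 []) := by
  rw [← steps_src3] at h
  have e : (PMon.tgt4 (x := ()) (y := ()) (gen₁ G n β)).steps =
      interchange.steps (x := ()) (y := ()) (z := ()) (cat (bar n) (pol2.src2 β))
        (cat (bar n) (bar 1)) [Whisker2.lw (bar n) (whisker2 0 β 0)]
        (pol3.src3 (x := ()) (y := ()) G).steps ++
      [Whisker3.lv [Whisker2.lw (pol3.src3 (x := ()) (y := ()) G).src
          (Whisker2.lw (bar n) (whisker2 0 β 0))]
        (Whisker3.rw ⟨[], .nil, G, .nil, []⟩ (cat (bar n) (bar 1)))] := rfl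
  rw [e, h, ← cat_bar, ← cat_bar, ← src2_eq]
  rfl

theorem head_src_nat₂ (G : Gen3) (s n : ℕ) (α : Gen2)
    (h : (pol3.src3 (x := ()) (y := ()) G).src = bar s) :
    (PMon.src4 (x := ()) (y := ()) (gen₂ α n G)).steps.head? =
      some (whisker3 [whisker2 0 α (n + s)] (1 + n) G 0 []) := by
  refine congrArg some ?_
  have e₁ : ((whisker2 0 α 0).rw (bar n)).rw (bar s) = whisker2 0 α (n + s) := by
    rw [rw_whisker2, rw_whisker2, Nat.zero_add]
  rw [← e₁, ← h]
  exact whisker3_mk _ G _ (cat_bar 1 n) rfl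

/-- Here α moves down through the source of `G`, so the first exchange is with the upper of its two
whiskers, and the lower one `v` stays below. -/
theorem head_tgt_nat₂ (G : Gen3) (n : ℕ) (α : Gen2) (v a γ b)
    (h : srcSteps G = [whisker2 a γ b, v]) :
    (PMon.tgt4 (x := ()) (y := ()) (gen₂ α n G)).steps.head? =
      some (whisker3 [] 0 (.X α (bar (n + a)) γ) b [v.lw (bar (1 + n))]) := by
  rw [← steps_src3] at h
  have e : (PMon.tgt4 (x := ()) (y := ()) (gen₂ α n G)).steps =
      interchange.steps (x := ()) (y := ()) (z := ()) (pol3.src3 (x := ()) (y := ()) G).src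
        (pol3.src3 (x := ()) (y := ()) G).tgt
        (pol3.src3 (x := ()) (y := ()) G).steps [(whisker2 0 α 0).rw (bar n)] ++
      [Whisker3.rv (Whisker3.lw (cat (pol2.src2 α) (bar n)) ⟨[], .nil, G, .nil, []⟩)
        [Whisker2.rw ((whisker2 0 α 0).rw (bar n)) (pol3.src3 (x := ()) (y := ()) G).tgt]] := rfl
  rw [e, h, rw_whisker2, Nat.zero_add, ← cat_bar, ← cat_bar]
  rfl

end PseudoMonoid
end GrayCoherence

/-! ### Overlapping branchings of `PMon` -/

namespace GrayCoherence

/-- Since `W₁` starts at φ', its source whiskers are those of φ', and a nonempty list of whiskers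
determines the 2-cell. Hence branchings can be identified by comparing lists only. -/
theorem Pol4.Joinable.of_steps {P : Pol4} {x y : P.P0} {φ φ' : Cell2 P.toPol2 x y}
    {W₁ W₂ : Whisker3 P.toPol3 x y} (h : P.Joinable φ' W₁ W₂)
    (hφ : φ.steps = W₁.top ++ (W₁.midSrc.steps ++ W₁.bot)) (hn : φ.steps ≠ []) :
    P.Joinable φ W₁ W₂ := by
  obtain ⟨⟨f₁, g₁, l₁, k₁⟩, F₂, rfl, hE, h₁, h₂⟩ := h
  refine ⟨⟨f₁, g₁, l₁, k₁⟩, F₂, ?_, hE, h₁, h₂⟩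
  rcases l₁ with _ | ⟨W, l₁⟩
  · simp at h₁
  obtain rfl : W = W₁ := by simpa using h₁
  obtain ⟨c, hc, -⟩ := k₁
  exact (Cell2.ext_steps (hφ.trans hc.steps_eq.1.symm) hn).symm

namespace PseudoMonoid
open Gen2

/-- The whiskers of `l̄ ∘₀ s(G) ∘₀ r̄`. -/
def ctxSteps (l : ℕ) (G : Gen3) (r : ℕ) : List (Whisker2 pol2 () ()) :=
  ((srcSteps G).map (Whisker2.lw (bar l))).map (fun w => w.rw (bar r))

theorem ctxSteps_A (l r : ℕ) :
    ctxSteps l .A r = [whisker2 l mu (r + 1), whisker2 l mu r] := by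
  simp [ctxSteps, srcSteps, lw_whisker2, rw_whisker2, Nat.add_comm]

theorem ctxSteps_L (l r : ℕ) :
    ctxSteps l .L r = [whisker2 l eta (r + 1), whisker2 l mu r] := by
  simp [ctxSteps, srcSteps, lw_whisker2, rw_whisker2, Nat.add_comm]

theorem ctxSteps_R (l r : ℕ) :
    ctxSteps l .R r = [whisker2 (l + 1) eta r, whisker2 l mu r] := by
  simp [ctxSteps, srcSteps, lw_whisker2, rw_whisker2]

theorem ctxSteps_X (l r : ℕ) (α n β) :
    ctxSteps l (.X α (bar n) β) r =
      [whisker2 l α (n + β.width + r), whisker2 (l + 1 + n) β r] := by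
  simp [ctxSteps, srcSteps, lw_whisker2, rw_whisker2, length_bar, Nat.add_assoc]

/-- A 4-generator fills the branching formed by the first steps of its two boundary paths.
Whiskering by l̄ and r̄ transports this filling to every horizontal position, and φ needs to be
known only through its whiskers. -/
theorem joinable_of_gen (S : PMon.P4 () ()) {top₁ l₁ G₁ r₁ bot₁ top₂ l₂ G₂ r₂ bot₂}
    (h₁ : (PMon.src4 S).steps.head? = some (whisker3 top₁ l₁ G₁ r₁ bot₁))
    (h₂ : (PMon.tgt4 S).steps.head? = some (whisker3 top₂ l₂ G₂ r₂ bot₂)) (l r : ℕ)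
    {φ : Cell2 pol2 () ()}
    (hφ : φ.steps = (top₁.map (Whisker2.lw (bar l))).map (fun w => w.rw (bar r)) ++
      (ctxSteps (l + l₁) G₁ (r₁ + r) ++
        (bot₁.map (Whisker2.lw (bar l))).map (fun w => w.rw (bar r)))) (hn : φ.steps ≠ []) :
    PMon.Joinable (x := ()) (y := ()) φ
      (whisker3 ((top₁.map (Whisker2.lw (bar l))).map (fun w => w.rw (bar r))) (l + l₁) G₁ (r₁ + r)
        ((bot₁.map (Whisker2.lw (bar l))).map (fun w => w.rw (bar r))))
      (whisker3 ((top₂.map (Whisker2.lw (bar l))).map (fun w => w.rw (bar r))) (l + l₂) G₂ (r₂ + r)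
        ((bot₂.map (Whisker2.lw (bar l))).map (fun w => w.rw (bar r)))) := by
  have h := ((Pol4.Joinable.of_gen S rfl h₁ h₂).lw (bar l)).rw (bar r)
  have e₁ := lw_whisker3 l top₁ l₁ G₁ r₁ bot₁
  have e₂ := lw_whisker3 l top₂ l₂ G₂ r₂ bot₂
  have e₃ := rw_whisker3 r (top₁.map (Whisker2.lw (bar l))) (l + l₁) G₁ r₁
    (bot₁.map (Whisker2.lw (bar l)))
  have e₄ := rw_whisker3 r (top₂.map (Whisker2.lw (bar l))) (l + l₂) G₂ r₂
    (bot₂.map (Whisker2.lw (bar l)))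
  rw [← e₁] at e₃
  rw [← e₂] at e₄
  rw [← e₃, ← e₄]
  refine h.of_steps ?_ hn
  rw [hφ]
  have e₅ := midSrc_whisker3 ((top₁.map (Whisker2.lw (bar l))).map (fun w => w.rw (bar r)))
    (l + l₁) G₁ (r₁ + r) ((bot₁.map (Whisker2.lw (bar l))).map (fun w => w.rw (bar r)))
  rw [← e₃] at e₅
  exact congrArg (fun k => (top₁.map (Whisker2.lw (bar l))).map (fun w => w.rw (bar r)) ++
    (k ++ (bot₁.map (Whisker2.lw (bar l))).map (fun w => w.rw (bar r)))) e₅.symm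

/-- The lower whisker of the source of `G` is at its right edge (final entry 0 in `hG`). An
interchange of that whisker with a β further right therefore involves a β lying outside `G`, and
naturality with respect to β fills the branching. -/
theorem joinable_nat₁ {φ : Cell2 pol2 () ()} {G : Gen3} {l r n l' r' i p q : ℕ} {β γ δ : Gen2}
    {a : Whisker2 pol2 () ()} (ht : (pol3.src3 (x := ()) (y := ()) G).tgt = bar (i + 1))
    (hG : srcSteps G = [whisker2 p δ q, whisker2 i γ 0])
    (ha : ctxSteps l G r = [a, whisker2 l' γ (n + β.width + r')])
    (hφ : φ.steps = ctxSteps l G r ++ [whisker2 (l' + 1 + n) β r']) :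
    PMon.Joinable (x := ()) (y := ()) φ (whisker3 [] l G r [whisker2 (l' + 1 + n) β r'])
      (whisker3 [a] l' (.X γ (bar n) β) r' []) := by
  have ha' := ha
  simp only [ctxSteps, hG, List.map_cons, List.map_nil, lw_whisker2, rw_whisker2, List.cons.injEq,
    whisker2_inj, Nat.zero_add] at ha'
  -- Comparing positions gives l' = l + i and r = n + β.width + r': the inputs of β are among the
  -- strands to the right of `G`.
  obtain ⟨rfl, ⟨rfl, -, rfl⟩, -⟩ := ha'
  have e₁ : l + (i + 1 + n) = l + i + 1 + n := by omega
  have e₂ : q + (n + β.width) + r' = q + (n + β.width + r') := by omega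
  have h := joinable_of_gen _ (head_src_nat₁ G _ n β ht) (head_tgt_nat₁ G n β _ _ _ _ hG) l r'
    (φ := φ)
  simp only [List.map_nil, List.map_cons, lw_whisker2, rw_whisker2, Nat.zero_add, Nat.add_zero, e₁,
    e₂] at h
  exact h (by simpa using hφ) (by simp [hφ])

/-- The mirror situation: α is to the left of the upper whisker of `G`. That whisker has `i` strands
of `G` on its left, so α lies outside `G` exactly when the gap is at least `i`, which is why the gap
is written `n + i`. -/
theorem joinable_nat₂ {φ : Cell2 pol2 () ()} {G : Gen3} {l r n l' r' i j p q : ℕ}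
    {α γ δ : Gen2} {d : Whisker2 pol2 () ()}
    (hs : (pol3.src3 (x := ()) (y := ()) G).src = bar (i + γ.width + j))
    (hG : srcSteps G = [whisker2 i γ j, whisker2 p δ q])
    (ha : ctxSteps l' G r' = [whisker2 (l + 1 + (n + i)) γ r, d])
    (hφ : φ.steps = whisker2 l α (n + i + γ.width + r) :: ctxSteps l' G r') :
    PMon.Joinable (x := ()) (y := ()) φ (whisker3 [] l (.X α (bar (n + i)) γ) r [d])
      (whisker3 [whisker2 l α (n + i + γ.width + r)] l' G r' []) := by
  have ha' := ha
  simp only [ctxSteps, hG, List.map_cons, List.map_nil, lw_whisker2, rw_whisker2, List.cons.injEq,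
    whisker2_inj] at ha'
  obtain ⟨⟨hl, -, rfl⟩, rfl, -⟩ := ha'
  obtain rfl : l' = l + 1 + n := by omega
  have e₁ : n + (i + γ.width + j) + r' = n + i + γ.width + (j + r') := by omega
  have e₂ : l + (1 + n + p) = l + 1 + n + p := by omega
  have e₃ : l + (1 + n) = l + 1 + n := by omega
  have h := joinable_of_gen _ (head_src_nat₂ G _ n α hs) (head_tgt_nat₂ G n α _ _ _ _ hG) l r'
    (φ := φ)
  simp only [List.map_nil, List.map_cons, lw_whisker2, rw_whisker2, Nat.zero_add, Nat.add_zero, e₁,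
    e₂, e₃] at h
  -- The naturality generator lists the step `G` on its source side and the interchange on its
  -- target side, hence the symmetry.
  exact (h (by simpa using hφ) (by simp [hφ])).symm

/-- The five additional generators as `4`-generators of `PMon`. -/
def extra (R : Gen4) : PMon.P4 () () := Sum.inr R

/-- The shared whisker `b` is the lower whisker of `G₁` and the upper whisker of `G₂`. Matching its
generator and its position leaves a short list of pairs, each filled by a naturality generator or by
one of R₁, …, R₅. -/
theorem joinable_overlap {φ : Cell2 pol2 () ()} {G₁ G₂ : Gen3} {l₁ r₁ l₂ r₂ : ℕ}
    {a b d : Whisker2 pol2 () ()} (h₁ : ctxSteps l₁ G₁ r₁ = [a, b])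
    (h₂ : ctxSteps l₂ G₂ r₂ = [b, d]) (hφ : φ.steps = [a, b, d]) :
    PMon.Joinable (x := ()) (y := ()) φ (whisker3 [] l₁ G₁ r₁ [d])
      (whisker3 [a] l₂ G₂ r₂ []) := by
  have hn : φ.steps ≠ [] := by simp [hφ]
  -- If the lower step is an interchange, naturality always applies, because the lower whisker of
  -- every source, including that of an interchange, is at the right edge.
  have hX : ∀ γ n β, G₂ = .X γ (bar n) β → PMon.Joinable (x := ()) (y := ()) φ
      (whisker3 [] l₁ G₁ r₁ [d]) (whisker3 [a] l₂ G₂ r₂ []) := by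
    rintro γ n β rfl
    rw [ctxSteps_X] at h₂
    simp only [List.cons.injEq] at h₂
    obtain ⟨rfl, rfl, -⟩ := h₂
    have hφ' : φ.steps = ctxSteps l₁ G₁ r₁ ++ [whisker2 (l₂ + 1 + n) β r₂] := by
      rw [hφ, h₁]; rfl
    have h₁' := h₁
    induction G₁ using exists_gen3 with
    | hA =>
      simp only [ctxSteps_A, List.cons.injEq, whisker2_inj] at h₁'
      obtain ⟨-, ⟨-, rfl, -⟩, -⟩ := h₁'
      exact joinable_nat₁ (i := 0) rfl rfl h₁ hφ'
    | hL =>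
      simp only [ctxSteps_L, List.cons.injEq, whisker2_inj] at h₁'
      obtain ⟨-, ⟨-, rfl, -⟩, -⟩ := h₁'
      exact joinable_nat₁ (i := 0) rfl rfl h₁ hφ'
    | hR =>
      simp only [ctxSteps_R, List.cons.injEq, whisker2_inj] at h₁'
      obtain ⟨-, ⟨-, rfl, -⟩, -⟩ := h₁'
      exact joinable_nat₁ (i := 0) rfl rfl h₁ hφ'
    | hX α m γ' =>
      simp only [ctxSteps_X, List.cons.injEq, whisker2_inj] at h₁'
      obtain ⟨-, ⟨-, rfl, -⟩, -⟩ := h₁'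
      -- In the source of X_{α,m̄,γ'} the lower whisker has on its left the single output of α and
      -- the m strands of the gap.
      refine joinable_nat₁ (i := 1 + m) (p := 0) (q := m + γ'.width) (δ := α) ?_ ?_ h₁ hφ'
      · exact (cat_bar 1 (m + 1)).trans (by rw [Nat.add_assoc])
      · simp [srcSteps, length_bar]
  induction G₂ using exists_gen3 with
  | hX γ n β => exact hX γ n β rfl
  | hA =>
    rw [ctxSteps_A] at h₂
    simp only [List.cons.injEq] at h₂
    obtain ⟨rfl, rfl, -⟩ := h₂
    induction G₁ using exists_gen3 with
    | hA =>
      simp only [ctxSteps_A, List.cons.injEq, whisker2_inj] at h₁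
      obtain ⟨rfl, ⟨rfl, -, rfl⟩, -⟩ := h₁
      have h := joinable_of_gen (extra .R₁) (top₁ := []) (l₁ := 0) (G₁ := .A) (r₁ := 1)
        (bot₁ := [whisker2 0 mu 0]) (top₂ := [whisker2 0 mu 2]) (l₂ := 0) (G₂ := .A) (r₂ := 0)
        (bot₂ := []) rfl rfl l₁ r₂ (φ := φ)
      simp only [List.map_nil, List.map_cons, lw_whisker2, rw_whisker2, Nat.zero_add,
        Nat.add_zero, ctxSteps_A, Nat.add_comm 1, Nat.add_comm 2] at h
      exact h hφ hn
    | hL =>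
      simp only [ctxSteps_L, List.cons.injEq, whisker2_inj] at h₁
      obtain ⟨rfl, ⟨rfl, -, rfl⟩, -⟩ := h₁
      have h := joinable_of_gen (extra .R₂) (top₂ := []) (l₂ := 0) (G₂ := .L) (r₂ := 1)
        (bot₂ := [whisker2 0 mu 0]) (top₁ := [whisker2 0 eta 2]) (l₁ := 0) (G₁ := .A) (r₁ := 0)
        (bot₁ := []) rfl rfl l₁ r₂ (φ := φ)
      simp only [List.map_nil, List.map_cons, lw_whisker2, rw_whisker2, Nat.zero_add,
        Nat.add_zero, ctxSteps_A, Nat.add_comm 1, Nat.add_comm 2] at h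
      exact (h hφ hn).symm
    | hR =>
      simp only [ctxSteps_R, List.cons.injEq, whisker2_inj] at h₁
      obtain ⟨rfl, ⟨rfl, -, rfl⟩, -⟩ := h₁
      have h := joinable_of_gen (extra .R₄) (top₂ := []) (l₂ := 0) (G₂ := .R) (r₂ := 1)
        (bot₂ := [whisker2 0 mu 0]) (top₁ := [whisker2 1 eta 1]) (l₁ := 0) (G₁ := .A) (r₁ := 0)
        (bot₁ := []) rfl rfl l₁ r₂ (φ := φ)
      simp only [List.map_nil, List.map_cons, lw_whisker2, rw_whisker2, Nat.zero_add,
        Nat.add_zero, ctxSteps_A, Nat.add_comm 1] at h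
      exact (h hφ hn).symm
    | hX α m γ =>
      simp only [ctxSteps_X, List.cons.injEq, whisker2_inj] at h₁
      obtain ⟨rfl, ⟨rfl, rfl, rfl⟩, -⟩ := h₁
      exact joinable_nat₂ (G := .A) (n := m) (i := 0) (j := 1) (p := 0) (q := 0) rfl rfl
        (ctxSteps_A _ _) (by rw [hφ, ctxSteps_A]; rfl)
  | hL =>
    rw [ctxSteps_L] at h₂
    simp only [List.cons.injEq] at h₂
    obtain ⟨rfl, rfl, -⟩ := h₂
    induction G₁ using exists_gen3 with
    -- The sources of A, L and R end with μ, whereas that of L begins with η; only an interchange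
    -- can overlap here. The same holds for R below.
    | hA => simp [ctxSteps_A, whisker2_inj] at h₁
    | hL => simp [ctxSteps_L, whisker2_inj] at h₁
    | hR => simp [ctxSteps_R, whisker2_inj] at h₁
    | hX α m γ =>
      simp only [ctxSteps_X, List.cons.injEq, whisker2_inj] at h₁
      obtain ⟨rfl, ⟨rfl, rfl, rfl⟩, -⟩ := h₁
      exact joinable_nat₂ (G := .L) (n := m) (i := 0) (j := 1) (p := 0) (q := 0) rfl rfl
        (ctxSteps_L _ _) (by rw [hφ, ctxSteps_L]; rfl)
  | hR =>
    rw [ctxSteps_R] at h₂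
    simp only [List.cons.injEq] at h₂
    obtain ⟨rfl, rfl, -⟩ := h₂
    induction G₁ using exists_gen3 with
    | hA => simp [ctxSteps_A, whisker2_inj] at h₁
    | hL => simp [ctxSteps_L, whisker2_inj] at h₁
    | hR => simp [ctxSteps_R, whisker2_inj] at h₁
    | hX α m γ =>
      simp only [ctxSteps_X, List.cons.injEq, whisker2_inj] at h₁
      obtain ⟨rfl, ⟨hl, rfl, rfl⟩, -⟩ := h₁
      -- The upper η of R has one strand of R on its left. With no gap that strand is the output of
      -- α, and the branching is R₃ or R₅ according to α; with a gap, α is outside R and naturality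
      -- applies.
      rcases m with _ | m
      · obtain rfl : l₂ = l₁ := by omega
        rcases α with _ | _
        · have h := joinable_of_gen (extra .R₃) (top₁ := []) (l₁ := 0) (G₁ := .X mu (bar 0) eta)
            (r₁ := 0) (bot₁ := [whisker2 0 mu 0]) (top₂ := [whisker2 0 mu 0]) (l₂ := 0) (G₂ := .R)
            (r₂ := 0) (bot₂ := []) rfl rfl l₂ r₁ (φ := φ)
          simp only [List.map_nil, List.map_cons, lw_whisker2, rw_whisker2, Nat.zero_add,
            Nat.add_zero, ctxSteps_X] at h
          simp only [width, Nat.zero_add, Nat.add_zero] at h hφ ⊢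
          exact h hφ hn
        · have h := joinable_of_gen (extra .R₅) (top₁ := []) (l₁ := 0) (G₁ := .X eta (bar 0) eta)
            (r₁ := 0) (bot₁ := [whisker2 0 mu 0]) (top₂ := [whisker2 0 eta 0]) (l₂ := 0)
            (G₂ := .R) (r₂ := 0) (bot₂ := []) rfl rfl l₂ r₁ (φ := φ)
          simp only [List.map_nil, List.map_cons, lw_whisker2, rw_whisker2, Nat.zero_add,
            Nat.add_zero, ctxSteps_X] at h
          simp only [width, Nat.zero_add, Nat.add_zero] at h hφ ⊢
          exact h hφ hn
      · obtain rfl : l₂ = l₁ + 1 + m := by omega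
        exact joinable_nat₂ (G := .R) (n := m) (i := 1) (j := 0) (p := 0) (q := 0) rfl rfl
          (ctxSteps_R _ _) (by rw [hφ, ctxSteps_R])

end PseudoMonoid
end GrayCoherence

/-! ### All branchings of `PMon` are joinable -/

namespace GrayCoherence
namespace PseudoMonoid
open Gen2

theorem exists_ctxSteps (l : ℕ) (G : Gen3) (r : ℕ) : ∃ a b, ctxSteps l G r = [a, b] := by
  cases G <;> exact ⟨_, _, rfl⟩

/-- From the upper to the lower whisker, the left position is unchanged for A and L, drops by one
for R, and strictly increases for an interchange; A and L differ in the upper generator. -/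
theorem ctxSteps_inj {l G r l' G' r'} (h : ctxSteps l G r = ctxSteps l' G' r') :
    l = l' ∧ G = G' ∧ r = r' := by
  induction G using exists_gen3 <;> induction G' using exists_gen3 <;>
    simp [ctxSteps_A, ctxSteps_L, ctxSteps_R, ctxSteps_X, whisker2_inj] at h ⊢ <;> grind

theorem joinable_of_top_prefix {φ : Cell2 pol2 () ()} {l₁ G₁ r₁ bot₁ l₂ G₂ r₂ bot₂}
    {top ws : List (Whisker2 pol2 () ())} {ψ : Cell2 pol2 () ()}
    (hW : (whisker3 top l₁ G₁ r₁ bot₁).Step φ ψ)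
    (hφ : φ.steps = top ++ (ctxSteps l₁ G₁ r₁ ++ bot₁))
    (h : ctxSteps l₁ G₁ r₁ ++ bot₁ = ws ++ (ctxSteps l₂ G₂ r₂ ++ bot₂)) :
    PMon.Joinable (x := ()) (y := ()) φ (whisker3 top l₁ G₁ r₁ bot₁)
      (whisker3 (top ++ ws) l₂ G₂ r₂ bot₂) := by
  obtain ⟨a, b, h₁⟩ := exists_ctxSteps l₁ G₁ r₁
  obtain ⟨c, d, h₂⟩ := exists_ctxSteps l₂ G₂ r₂
  have hv := φ.valid
  -- The length of `ws` is the vertical distance between the two redexes. As each occupies two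
  -- whiskers, they are equal at distance 0, share one whisker at distance 1, and are disjoint from
  -- distance 2 on.
  rcases ws with _ | ⟨w, _ | ⟨w', ws⟩⟩
  · have e : ctxSteps l₁ G₁ r₁ = ctxSteps l₂ G₂ r₂ := by
      rw [h₁, h₂] at h ⊢
      simp at h
      simp [h]
    rw [e] at h
    obtain rfl := List.append_cancel_left h
    obtain ⟨rfl, rfl, rfl⟩ := ctxSteps_inj e
    rw [List.append_nil]
    exact Pol4.Joinable.of_step (P := PMon.toPol4) hW
  · rw [h₁, h₂] at h
    simp only [List.cons_append, List.nil_append, List.cons.injEq] at h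
    obtain ⟨rfl, rfl, rfl⟩ := h
    rw [h₁] at hφ
    replace hφ : φ.steps = top ++ ([a, b, d] ++ bot₂) := hφ
    rw [hφ] at hv
    obtain ⟨p, -, hv⟩ := hv.of_append
    obtain ⟨q, hv, -⟩ := hv.of_append
    have h₃ : PMon.Joinable (x := ()) (y := ()) φ (whisker3 (top ++ []) l₁ G₁ r₁ (d :: bot₂))
        (whisker3 (top ++ [a]) l₂ G₂ r₂ bot₂) :=
      (joinable_overlap (φ := ⟨p, q, [a, b, d], hv⟩) h₁ h₂ rfl).context top bot₂ hφ
        (List.cons_ne_nil _ _)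
    rwa [List.append_nil] at h₃
  · rw [h₁] at h
    simp only [List.cons_append, List.nil_append, List.cons.injEq] at h
    obtain ⟨rfl, rfl, rfl⟩ := h
    replace hφ : φ.steps = top ++ ((ctxSteps l₁ G₁ r₁ ++ (ws ++ ctxSteps l₂ G₂ r₂)) ++ bot₂) := by
      rw [hφ]; simp
    rw [hφ] at hv
    obtain ⟨p, -, hv⟩ := hv.of_append
    obtain ⟨q, hv, -⟩ := hv.of_append
    have e₁ : (((pol3.src3 (x := ()) (y := ()) G₁).lw (bar l₁)).rw (bar r₁)).steps =
      ctxSteps l₁ G₁ r₁ := midSrc_whisker3 [] l₁ G₁ r₁ []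
    have e₂ : (((pol3.src3 (x := ()) (y := ()) G₂).lw (bar l₂)).rw (bar r₂)).steps =
      ctxSteps l₂ G₂ r₂ := midSrc_whisker3 [] l₂ G₂ r₂ []
    have e₃ : ∀ G, (pol3.src3 (x := ()) (y := ()) G).steps ≠ [] := by
      intro G
      have h := steps_src3 G
      intro h'
      cases G <;> exact List.cons_ne_nil _ _ (h.symm.trans h')
    have h₃ := (Pol4.Joinable.indep (P := PMon) (x := ()) (y := ()) (x₁ := ()) (y₁ := ())
      (x₂ := ()) (y₂ := ()) (φ := ⟨p, q, _, hv⟩) (bar l₁) G₁ (bar r₁) ws (bar l₂) G₂ (bar r₂)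
      (e₃ _) (e₃ _) (congrArg₂ (fun s t => s ++ (ws ++ t)) e₁ e₂).symm).context top bot₂ hφ
      (fun h' => List.cons_ne_nil a (b :: (ws ++ ctxSteps l₂ G₂ r₂))
        ((congrArg (· ++ (ws ++ ctxSteps l₂ G₂ r₂)) h₁).symm.trans h'))
    have h₄ : PMon.Joinable (x := ()) (y := ()) φ
        (whisker3 (top ++ []) l₁ G₁ r₁ ((ws ++ ctxSteps l₂ G₂ r₂) ++ bot₂))
        (whisker3 (top ++ (ctxSteps l₁ G₁ r₁ ++ ws)) l₂ G₂ r₂ bot₂) := by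
      rw [← e₁, ← e₂]
      exact h₃
    rwa [List.append_nil, List.append_assoc, h₁] at h₄

theorem joinable (φ ψ₁ ψ₂ : Cell2 pol2 () ()) (W₁ W₂ : Whisker3 pol3 () ())
    (h₁ : W₁.Step φ ψ₁) (h₂ : W₂.Step φ ψ₂) : PMon.Joinable (x := ()) (y := ()) φ W₁ W₂ := by
  obtain ⟨top₁, l₁, G₁, r₁, bot₁, rfl⟩ := exists_eq_whisker3 W₁
  obtain ⟨top₂, l₂, G₂, r₂, bot₂, rfl⟩ := exists_eq_whisker3 W₂
  have e₁ : φ.steps = top₁ ++ (ctxSteps l₁ G₁ r₁ ++ bot₁) := by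
    have h := h₁.steps_eq.1
    rwa [midSrc_whisker3] at h
  have e₂ : φ.steps = top₂ ++ (ctxSteps l₂ G₂ r₂ ++ bot₂) := by
    have h := h₂.steps_eq.1
    rwa [midSrc_whisker3] at h
  -- One of the two parts above the redexes is a prefix of the other; by symmetry the first redex
  -- may be taken to be the higher one.
  rcases List.append_eq_append_iff.1 (e₁.symm.trans e₂) with ⟨ws, rfl, h⟩ | ⟨ws, rfl, h⟩
  · exact joinable_of_top_prefix h₁ e₁ h
  · exact (joinable_of_top_prefix h₂ e₂ h).symm

/-! ### Termination -/

/-- The action of `l̄ ∘₀ α ∘₀ r̄` on sequences of sizes of trees. -/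
def actAt (l : ℕ) (σ : ℕ → ℕ) : Gen2 → ℕ → ℕ
  | mu => fun i => if i < l then σ i else if i = l then σ i + σ (i + 1) else σ (i + 1)
  | eta => fun i => if i < l then σ i else if i = l then 1 else σ (i - 1)

/-- The size of the left subtree if `α` is `μ`. -/
def costAt (l : ℕ) (σ : ℕ → ℕ) : Gen2 → ℕ
  | mu => σ l
  | eta => 0

/-- The action of a whisker on sequences of sizes of trees. -/
def act (σ : ℕ → ℕ) (w : Whisker2 pol2 () ()) : ℕ → ℕ := actAt w.l.length σ w.α

/-- The sum of the sizes of the left subtrees at all the occurrences of `μ`. -/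
def cost (σ : ℕ → ℕ) : List (Whisker2 pol2 () ()) → ℕ
  | [] => 0
  | w :: ws => costAt w.l.length σ w.α + cost (act σ w) ws

/-- The weighted sum of the positions of the whiskers. -/
def weight : List (Whisker2 pol2 () ()) → ℕ
  | [] => 0
  | w :: ws => w.l.length + 3 * weight ws

theorem act_whisker2 (σ l α r) : act σ (whisker2 l α r) = actAt l σ α :=
  congrArg (fun k => actAt k σ α) (length_bar l)

theorem cost_nil (σ) : cost σ [] = 0 := rfl

theorem cost_cons (σ l α r ws) :
    cost σ (whisker2 l α r :: ws) = costAt l σ α + cost (actAt l σ α) ws :=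
  congrArg₂ (fun k τ => costAt k σ α + cost τ ws) (length_bar l) (act_whisker2 σ l α r)

theorem weight_cons (l α r ws) : weight (whisker2 l α r :: ws) = l + 3 * weight ws :=
  congrArg (fun k => k + 3 * weight ws) (length_bar l)

theorem weight_lt_append (ws : List (Whisker2 pol2 () ())) {vs vs'} (h : weight vs < weight vs') :
    weight (ws ++ vs) < weight (ws ++ vs') := by
  induction ws with
  | nil => exact h
  | cons w ws ih => simp only [List.cons_append, weight]; omega

/-- The upper part of a 2-cell influences the cost of the lower part only through the sequence of
sizes that it produces. A local rewriting that preserves this sequence therefore leaves the cost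
below it unchanged. -/
theorem cost_append (σ : ℕ → ℕ) (ws vs) :
    cost σ (ws ++ vs) = cost σ ws + cost (ws.foldl act σ) vs := by
  induction ws generalizing σ with
  | nil => simp [cost]
  | cons w ws ih => simp only [List.cons_append, cost, ih, List.foldl_cons]; omega

/-- That η creates a tree of size 1 rather than 0 matters here: A lowers the cost by the size of its
leftmost subtree, which must be positive. -/
theorem act_pos {σ : ℕ → ℕ} (hσ : ∀ i, 0 < σ i) (w) : ∀ i, 0 < act σ w i := by
  have h : ∀ l α i, 0 < actAt l σ α i := by
    intro l α i
    have := hσ i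
    have := hσ (i + 1)
    have := hσ (i - 1)
    cases α <;> simp only [actAt] <;> grind
  exact h _ _

theorem foldl_act_pos {σ : ℕ → ℕ} (hσ : ∀ i, 0 < σ i) (ws : List (Whisker2 pol2 () ())) :
    ∀ i, 0 < ws.foldl act σ i := by
  induction ws generalizing σ with
  | nil => exact hσ
  | cons w ws ih => exact ih (act_pos hσ w)

/-- The measure on `2`-cells that decreases under rewriting: the number of whiskers, then `cost`,
then `weight`. -/
def measure (φ : Cell2 pol2 () ()) : ℕ ×ₗ ℕ ×ₗ ℕ :=
  toLex (φ.steps.length, toLex (cost (fun _ => 1) φ.steps, weight φ.steps))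

/-- The whiskers of `l̄ ∘₀ t(G) ∘₀ r̄`. -/
def ctxTgtSteps (l : ℕ) (G : Gen3) (r : ℕ) : List (Whisker2 pol2 () ()) :=
  ((tgtSteps G).map (Whisker2.lw (bar l))).map (fun w => w.rw (bar r))

theorem act_A (σ : ℕ → ℕ) (l : ℕ) :
    actAt l (actAt l σ mu) mu = actAt l (actAt (l + 1) σ mu) mu := by
  funext i
  simp only [actAt]
  grind

/-- Exchanging two generators side by side changes only the order in which the trees are built,
hence neither the resulting sizes nor, in `cost_X`, the left subtrees. -/
theorem act_X (σ : ℕ → ℕ) (l n : ℕ) (α β : Gen2) :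
    actAt (l + 1 + n) (actAt l σ α) β = actAt l (actAt (l + α.width + n) σ β) α := by
  funext i
  cases α <;> cases β <;> simp only [actAt, width] <;> grind

theorem cost_X (σ : ℕ → ℕ) (l n : ℕ) (α β : Gen2) :
    costAt l σ α + costAt (l + 1 + n) (actAt l σ α) β =
      costAt (l + α.width + n) σ β + costAt l (actAt (l + α.width + n) σ β) α := by
  cases α <;> cases β <;> simp only [actAt, costAt, width] <;> grind

theorem measure_lt {φ ψ : Cell2 pol2 () ()} {W : Whisker3 pol3 () ()} (h : W.Step φ ψ) :
    measure ψ < measure φ := by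
  obtain ⟨top, l, G, r, bot, rfl⟩ := exists_eq_whisker3 W
  obtain ⟨e₁, e₂⟩ := h.steps_eq
  rw [midSrc_whisker3] at e₁
  rw [midTgt_whisker3] at e₂
  change φ.steps = top ++ (ctxSteps l G r ++ bot) at e₁
  change ψ.steps = top ++ (ctxTgtSteps l G r ++ bot) at e₂
  simp only [measure, Prod.Lex.toLex_lt_toLex, e₁, e₂]
  have hp := foldl_act_pos (σ := fun _ => 1) (fun _ => Nat.one_pos) top
  induction G using exists_gen3 with
  | hA =>
    -- With subtrees of sizes a, b, c, the left subtrees contribute a + (a + b) before A and b + a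
    -- after it.
    refine .inr ⟨by simp [ctxTgtSteps, ctxSteps, tgtSteps, srcSteps], .inl ?_⟩
    rw [cost_append, cost_append _ top, ctxSteps_A, cost_append, cost_append _ [_, _]]
    have e : ctxTgtSteps l .A r = [whisker2 (l + 1) mu r, whisker2 l mu r] := by
      simp [ctxTgtSteps, tgtSteps, lw_whisker2, rw_whisker2]
    rw [e]
    simp only [List.foldl_cons, List.foldl_nil, act_whisker2, cost_cons, cost_nil, act_A]
    simp only [costAt, actAt]
    have := hp l
    grind
  | hL | hR => exact .inl (by simp [ctxTgtSteps, ctxSteps, tgtSteps, srcSteps])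
  | hX α n β =>
    have e : ctxTgtSteps l (.X α (bar n) β) r =
        [whisker2 (l + α.width + n) β r, whisker2 l α (n + 1 + r)] := by
      simp [ctxTgtSteps, tgtSteps, lw_whisker2, rw_whisker2, length_bar, Nat.add_assoc]
    rw [e, ctxSteps_X]
    refine .inr ⟨by simp, .inr ⟨?_, weight_lt_append _ ?_⟩⟩
    · rw [cost_append, cost_append _ top, cost_append, cost_append _ [_, _]]
      simp only [List.foldl_cons, List.foldl_nil, act_whisker2, cost_cons, cost_nil, act_X,
        Nat.add_zero, cost_X]
    · simp only [List.cons_append, List.nil_append, weight_cons]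
      -- With the same list below, the inequality amounts to α.width + n < 3 (1 + n). The width of μ
      -- is 2, so the factor 3 in `weight` is the smallest natural number that works for n = 0.
      cases α <;> simp only [width] <;> omega

theorem wellFounded_red : WellFounded (PMon.Red (x := ()) (y := ())) :=
  Subrelation.wf (fun ⟨_, h⟩ => measure_lt h) (InvImage.wf measure wellFounded_lt)

end PseudoMonoid
end GrayCoherence

theorem mainTheorem9 : GrayCoherence.PMon.Coherent :=
  GrayCoherence.Pol4.localization_coherent GrayCoherence.PMon.toPol4
    (fun _ _ => GrayCoherence.PseudoMonoid.wellFounded_red)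
    (fun _ _ => GrayCoherence.PseudoMonoid.joinable)
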